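/- Let $G$ be an abelian group. A $G$-grading of a unital real algebra $R$ is a decomposition $R=\bigoplus_{g\in G}R_g$ into real subspaces with $R_gR_h\subseteq R_{gh}$ for all $g,h\in G$; it is a division grading if every nonzero element of every $R_g$ is invertible in $R$. Gradings of $R$ by $G$ and of $R'$ by $G'$ are weakly isomorphic if there are an isomorphism of real algebras $\varphi:R\to R'$ and a group isomorphism $\alpha:G\to G'$ with $\varphi(R_g)=R'_{\alpha(g)}$ for all $g\in G$. The tensor product over $\mathbb{R}$ of a $G$-graded algebra $R$ and an $H$-graded algebra $S$ is $R\otimes S$ graded by $G\times H$ with $(R\otimes S)_{(g,h)}=R_g\otimes S_h$; the $0$-th tensor power is $\mathbb{R}$ with the grading by the trivial group. Put $$A=\begin{pmatrix}1&0\\0&-1\end{pmatrix},\quad B=\begin{pmatrix}0&1\\1&0\end{pmatrix},\quad C=AB=\begin{pmatrix}0&1\\-1&0\end{pmatrix},\quad \omega=\tfrac{1}{\sqrt2}(1+i),$$ and write $\langle x\rangle=\mathbb{R}x$. Consider the following graded real algebras: * $\mathbb{C}^{(2)}$: the algebra $\mathbb{C}$ graded by $\mathbb{Z}_2$ with components $\langle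 1\rangle,\langle i\rangle$ in degrees $0,1$; * $M_2^{(4)}$: the algebra $M_2(\mathbb{R})$ graded by $\mathbb{Z}_2\times\mathbb{Z}_2$ with components $\langle I\rangle,\langle A\rangle,\langle B\rangle,\langle C\rangle$ in degrees $(0,0),(1,0),(0,1),(1,1)$; * $M_2^{(8)}$: the real algebra $M_2(\mathbb{C})$ graded by $\mathbb{Z}_4\times\mathbb{Z}_2$ with components $\langle I\rangle,\langle\omega A\rangle,\langle iI\rangle,\langle i\omega A\rangle$ in degrees $(0,0),(1,0),(2,0),(3,0)$ and $\langle C\rangle,\langle\omega B\rangle,\langle iC\rangle,\langle i\omega B\rangle$ in degrees $(0,1),(1,1),(2,1),(3,1)$. **Proposition.** Let $R=M_n(\mathbb{C})$, viewed as a real algebra, be given a division grading by an abelian group $G$ such that $\dim_{\mathbb{R}}R_g=1$ for every $g\in G$. Then $n=2^k$ for some integer $k\ge 0$, and one of the following holds: 1. the grading is weakly isomorphic to $(M_2^{(4)})^{\otimes k}\otimes\mathbb{C}^{(2)}$, and $G\cong\mathbb{Z}_2^{2k+1}$ is an elementary abelian $2$-group; 2. $k\ge 1$, the grading is weakly isomorphic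 to $M_2^{(8)}\otimes(M_2^{(4)})^{\otimes(k-1)}$, and $G\cong\mathbb{Z}_4\times\mathbb{Z}_2^{2k-1}$. Both forms occur: for every $k\ge 0$ in the first case, and for every $k\ge1$ in the second, the real algebra $M_{2^k}(\mathbb{C})$ has a division grading with one-dimensional components which is weakly isomorphic to the graded algebra named there. -/

import Mathlib

open scoped TensorProduct

noncomputable section

namespace RealDivGrading

/-- A grading is a *division grading* if every nonzero homogeneous element is invertible. -/
def IsDivisionGrading {G R : Type*} [Semiring R] [Algebra ℝ R] (𝒜 : G → Submodule ℝ R) : Prop :=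
  ∀ g : G, ∀ x ∈ 𝒜 g, x ≠ 0 → IsUnit x

/-- Weak isomorphism of gradings: an isomorphism of real algebras which carries components
to components along an isomorphism of the grading groups. -/
def WeaklyIsomorphic {G H R S : Type*} [AddGroup G] [AddGroup H]
    [Semiring R] [Algebra ℝ R] [Semiring S] [Algebra ℝ S]
    (𝒜 : G → Submodule ℝ R) (ℬ : H → Submodule ℝ S) : Prop :=
  ∃ (φ : R ≃ₐ[ℝ] S) (α : G ≃+ H), ∀ g : G, (𝒜 g).map φ.toLinearMap = ℬ (α g)

/-- The tensor product of a `G`-grading and an `H`-grading, a `G × H`-grading whose component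
of degree `(g, h)` is (the image of) `R_g ⊗ S_h`. -/
def tensorGrading {G H R S : Type*} [Semiring R] [Algebra ℝ R] [Semiring S] [Algebra ℝ S]
    (𝒜 : G → Submodule ℝ R) (ℬ : H → Submodule ℝ S) : G × H → Submodule ℝ (R ⊗[ℝ] S) :=
  fun p => Submodule.map₂ (TensorProduct.mk ℝ R S) (𝒜 p.1) (ℬ p.2)

/-- The `k`-th tensor power of a `G`-grading, a `G ^ k`-grading of `R ⊗ ⋯ ⊗ R` whose component
of degree `(g₁, …, g_k)` is spanned by the `x₁ ⊗ ⋯ ⊗ x_k` with `x_i` in `R_{g_i}`.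
For `k = 0` it is the field `ℝ`, graded by the trivial group. -/
def tensorPowerGrading {G R : Type*} [Semiring R] [Algebra ℝ R]
    (𝒜 : G → Submodule ℝ R) (k : ℕ) : (Fin k → G) → Submodule ℝ (⨂[ℝ] _ : Fin k, R) :=
  fun g => Submodule.span ℝ
    {t | ∃ x : Fin k → R, (∀ i, x i ∈ 𝒜 (g i)) ∧ t = PiTensorProduct.tprod ℝ x}

/-- `A = diag(1, -1)`. -/
def matA (K : Type*) [Ring K] : Matrix (Fin 2) (Fin 2) K := !![1, 0; 0, -1]

/-- The matrix `B`, the permutation matrix of the transposition. -/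
def matB (K : Type*) [Ring K] : Matrix (Fin 2) (Fin 2) K := !![0, 1; 1, 0]

/-- The matrix `C = A B`, with `C ^ 2 = -1`. -/
def matC (K : Type*) [Ring K] : Matrix (Fin 2) (Fin 2) K := !![0, 1; -1, 0]

/-- `ω = (1 + i) / √2`, the primitive 8th root of unity with `ω ^ 2 = i`. -/
def omega : ℂ := (1 + Complex.I) / (Real.sqrt 2 : ℂ)

/-- `ℂ^{(2)}`: the field `ℂ` graded by `ℤ₂`, with components `⟨1⟩` and `⟨i⟩`. -/
def gradC2 : ZMod 2 → Submodule ℝ ℂ :=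
  fun g => Submodule.span ℝ {Complex.I ^ g.val}

/-- `M₂^{(4)}`: the algebra `M₂(ℝ)` graded by `ℤ₂ × ℤ₂`, with components
`⟨1⟩`, `⟨A⟩`, `⟨B⟩`, `⟨A B⟩ = ⟨C⟩` in degrees `(0,0)`, `(1,0)`, `(0,1)`, `(1,1)`. -/
def gradM24 : ZMod 2 × ZMod 2 → Submodule ℝ (Matrix (Fin 2) (Fin 2) ℝ) :=
  fun g => Submodule.span ℝ {matA ℝ ^ g.1.val * matB ℝ ^ g.2.val}

/-- `M₂^{(8)}`: the real algebra `M₂(ℂ)` graded by `ℤ₄ × ℤ₂`, with `ω A` in degree `(1,0)` and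
`C` in degree `(0,1)`; the components of degrees `(0,0), …, (3,0)` are
`⟨1⟩, ⟨ω A⟩, ⟨i⟩, ⟨i ω A⟩` and those of degrees `(0,1), …, (3,1)` are
`⟨C⟩, ⟨ω B⟩, ⟨i C⟩, ⟨i ω B⟩`. -/
def gradM28 : ZMod 4 × ZMod 2 → Submodule ℝ (Matrix (Fin 2) (Fin 2) ℂ) :=
  fun g => Submodule.span ℝ {(omega • matA ℂ) ^ g.1.val * matC ℂ ^ g.2.val}

/-- The real algebra `M₂(ℝ)^{⊗ k} ⊗ ℂ`. -/
abbrev AlgOne (k : ℕ) : Type :=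
  (⨂[ℝ] _ : Fin k, Matrix (Fin 2) (Fin 2) ℝ) ⊗[ℝ] ℂ

/-- The real algebra `M₂(ℂ) ⊗ M₂(ℝ)^{⊗ m}`, tensor products over `ℝ`. -/
abbrev AlgTwo (m : ℕ) : Type :=
  Matrix (Fin 2) (Fin 2) ℂ ⊗[ℝ] (⨂[ℝ] _ : Fin m, Matrix (Fin 2) (Fin 2) ℝ)

/-- The graded algebra `(M₂^{(4)})^{⊗ k} ⊗ ℂ^{(2)}`. -/
def typeOne (k : ℕ) : (Fin k → ZMod 2 × ZMod 2) × ZMod 2 → Submodule ℝ (AlgOne k) :=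
  tensorGrading (tensorPowerGrading gradM24 k) gradC2

/-- The graded algebra `M₂^{(8)} ⊗ (M₂^{(4)})^{⊗ m}`. -/
def typeTwo (m : ℕ) :
    (ZMod 4 × ZMod 2) × (Fin m → ZMod 2 × ZMod 2) → Submodule ℝ (AlgTwo m) :=
  tensorGrading gradM28 (tensorPowerGrading gradM24 m)

end RealDivGrading

end

/-! The commutation of homogeneous elements decides everything. If `x` and `y` are nonzero
homogeneous, then `x * y` and `y * x` span the same line, so `x * y = r • (y * x)` with `r` real;
determinants give `r ^ n = 1`, hence `r = 1` or `r = -1`. The sign is an alternating biadditive form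
`β : G × G → ZMod 2` (`exists_form`). Homogeneous elements commuting with everything are complex
scalars, so the radical of `β` is `{0, f}`, where `f` is the degree of `i` (`exists_degree_I`).
Since `β` has values in characteristic two, every double `2 • g` lies in this radical.

If all doubles vanish, a maximal symplectic family together with `f` gives coordinates on `G`.
Multiplication by `i` shifts a degree by `f` and reverses the sign of a square, so the pairs can be
represented by anticommuting elements of square one. Each pair generates a copy of `M₂(ℝ)`, the
copies commute, and `i` supplies the factor `ℂ`.

If some double is `f`, the character recording whether `2 • g = f` kills `f`, so it is `β(·, c)` for
some `c` (`exists_form_eq`). An element `e` with `2 • e = f` then pairs to `1` with `c`, and `e`,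
`c` carry elements with squares `i` and `-1`, which generate the eight-dimensional factor.
Everything orthogonal to `c` is killed by two, so the complement of `e`, `c` is treated as in the
first case.

In both cases the homomorphism built from the model sends a homogeneous basis to a homogeneous
basis, hence is a weak isomorphism (`IsTwisted.weaklyIsomorphic`). Comparing real dimensions gives
`n`, and transporting the model bases to matrices gives existence. -/

noncomputable section

namespace RealDivGrading

/-! ### Alternating forms over `ZMod 2` on an abelian group. -/

section Symplectic

variable {G : Type*} [AddCommGroup G]

/-- A family of orthogonal hyperbolic pairs for a `ZMod 2`-valued biadditive form. -/
structure IsSymplectic (β : G →+ G →+ ZMod 2) {k : ℕ} (a b : Fin k → G) : Prop where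
  left : ∀ i j, β (a i) (a j) = 0
  right : ∀ i j, β (b i) (b j) = 0
  cross : ∀ i j, β (a i) (b j) = if i = j then 1 else 0

/-- The combination of a family of pairs with coefficients in `ZMod 2`. -/
def pairSum {k : ℕ} (a b : Fin k → G) (h : Fin k → ZMod 2 × ZMod 2) : G :=
  ∑ i, ((h i).1.val • a i + (h i).2.val • b i)

variable {β : G →+ G →+ ZMod 2}

theorem form_comm (hβ : ∀ x, β x x = 0) (x y : G) : β x y = β y x := by
  have h := hβ (x + y)
  simp only [map_add, AddMonoidHom.add_apply, hβ, zero_add, add_zero] at h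
  rw [← sub_eq_zero, CharTwo.sub_eq_add, add_comm]
  exact h

theorem form_val_nsmul_left (c : ZMod 2) (x y : G) : β (c.val • x) y = c * β x y := by
  rw [map_nsmul, AddMonoidHom.nsmul_apply, nsmul_eq_mul, ZMod.natCast_zmod_val]

theorem form_two_nsmul_left (x y : G) : β (2 • x) y = 0 := by
  rw [map_nsmul, AddMonoidHom.nsmul_apply, nsmul_eq_mul]
  exact mul_eq_zero_of_left (by decide) _

theorem form_pairSum {k : ℕ} (a b : Fin k → G) (h : Fin k → ZMod 2 × ZMod 2) (y : G) :
    β (pairSum a b h) y = ∑ i, ((h i).1 * β (a i) y + (h i).2 * β (b i) y) := by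
  simp only [pairSum, map_sum, map_add, AddMonoidHom.add_apply, form_val_nsmul_left,
    AddMonoidHom.finsetSum_apply]

theorem pairSum_mem {k : ℕ} {a b : Fin k → G} (K : AddSubgroup G)
    (hK : ∀ i, a i ∈ K ∧ b i ∈ K) (h : Fin k → ZMod 2 × ZMod 2) : pairSum a b h ∈ K :=
  K.sum_mem fun i _ => K.add_mem (K.nsmul_mem (hK i).1 _) (K.nsmul_mem (hK i).2 _)

theorem IsSymplectic.form_pairSum_right {k : ℕ} {a b : Fin k → G} (hs : IsSymplectic β a b)
    (h : Fin k → ZMod 2 × ZMod 2) (j : Fin k) : β (pairSum a b h) (b j) = (h j).1 := by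
  simp [form_pairSum, hs.right, hs.cross]

theorem IsSymplectic.form_pairSum_left (hβ : ∀ x, β x x = 0) {k : ℕ} {a b : Fin k → G}
    (hs : IsSymplectic β a b) (h : Fin k → ZMod 2 × ZMod 2) (j : Fin k) :
    β (pairSum a b h) (a j) = (h j).2 := by
  simp [form_pairSum, hs.left, form_comm hβ (b _), hs.cross]

/-- Subtracting the components along a symplectic family. -/
theorem IsSymplectic.sub_pairSum_orthogonal (hβ : ∀ x, β x x = 0) {k : ℕ} {a b : Fin k → G}
    (hs : IsSymplectic β a b) (v : G) (j : Fin k) :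
    β (v - pairSum a b fun i => (β v (b i), β v (a i))) (a j) = 0 ∧
      β (v - pairSum a b fun i => (β v (b i), β v (a i))) (b j) = 0 := by
  simp only [map_sub, AddMonoidHom.sub_apply, hs.form_pairSum_left hβ, hs.form_pairSum_right,
    sub_self, and_self]

theorem IsSymplectic.cons (hβ : ∀ x, β x x = 0) {k : ℕ} {a b : Fin k → G}
    (hs : IsSymplectic β a b) {u v : G} (huv : β u v = 1)
    (hu : ∀ j, β u (a j) = 0 ∧ β u (b j) = 0) (hv : ∀ j, β v (a j) = 0 ∧ β v (b j) = 0) :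
    IsSymplectic β (Fin.cons u a : Fin (k + 1) → G) (Fin.cons v b : Fin (k + 1) → G) where
  left i j := by
    refine Fin.cases ?_ (fun i => ?_) i <;> refine Fin.cases ?_ (fun j => ?_) j <;>
      simp [hβ, hu, form_comm hβ (a _) u, hs.left]
  right i j := by
    refine Fin.cases ?_ (fun i => ?_) i <;> refine Fin.cases ?_ (fun j => ?_) j <;>
      simp [hβ, hv, form_comm hβ (b _) v, hs.right]
  cross i j := by
    refine Fin.cases ?_ (fun i => ?_) i <;> refine Fin.cases ?_ (fun j => ?_) j <;>
      simp [hu, hv, huv, form_comm hβ (a _) v, hs.cross, (Fin.succ_ne_zero _).symm]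

/-- A maximal symplectic family in a subgroup: what is orthogonal to it is in the radical. -/
theorem exists_maximal_isSymplectic [Finite G] (hβ : ∀ x, β x x = 0) (K : AddSubgroup G) :
    ∃ (k : ℕ) (a b : Fin k → G), IsSymplectic β a b ∧ (∀ i, a i ∈ K ∧ b i ∈ K) ∧
      ∀ w ∈ K, (∀ i, β w (a i) = 0 ∧ β w (b i) = 0) → ∀ v ∈ K, β w v = 0 := by
  by_contra! hcon
  -- If no family were maximal, every family could be extended by a new pair, giving families of
  -- every length.
  have key : ∀ k : ℕ, ∃ a b : Fin k → G, IsSymplectic β a b ∧ ∀ i, a i ∈ K ∧ b i ∈ K := by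
    intro k
    induction k with
    | zero => exact ⟨fun _ => 0, fun _ => 0, ⟨fun i => i.elim0, fun i => i.elim0, fun i => i.elim0⟩,
        fun i => i.elim0⟩
    | succ k ih =>
      obtain ⟨a, b, hs, hK⟩ := ih
      obtain ⟨w, hwK, hw, v, hvK, hv⟩ := hcon k a b hs hK
      -- `p` is the projection of `v` to the family; as `w` is orthogonal to the family, replacing
      -- `v` by `v - p` keeps `β w v`.
      set p := pairSum a b fun i => (β v (b i), β v (a i)) with hp
      have hpw : β w p = 0 := by
        rw [form_comm hβ, hp, form_pairSum]
        refine Finset.sum_eq_zero fun i _ => ?_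
        rw [form_comm hβ (a i), form_comm hβ (b i), (hw i).1, (hw i).2]
        simp
      have h1 : ∀ c : ZMod 2, c ≠ 0 → c = 1 := by decide
      refine ⟨Fin.cons w a, Fin.cons (v - p) b,
        hs.cons hβ ?_ hw (hs.sub_pairSum_orthogonal hβ v), fun i => ?_⟩
      · rw [map_sub, hpw, sub_zero]
        exact h1 _ hv
      · refine Fin.cases ?_ (fun i => ?_) i
        · exact ⟨hwK, K.sub_mem hvK (pairSum_mem K hK _)⟩
        · simpa using hK i
  obtain ⟨a, b, hs, -⟩ := key (Nat.card G + 1)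
  have hinj : Function.Injective a := by
    intro i j hij
    have h := hs.cross i j
    rw [hij, hs.cross j j, if_pos rfl] at h
    by_contra hne
    rw [if_neg hne] at h
    exact one_ne_zero h
  have := Nat.card_le_card_of_injective a hinj
  simp at this

/-- A form with radical `{0, f}` represents every character vanishing at `f`. -/
theorem exists_form_eq [Finite G] (hβ : ∀ x, β x x = 0) {f : G}
    (hrad : ∀ w, (∀ v, β w v = 0) → w = 0 ∨ w = f) (q : G →+ ZMod 2) (hq : q f = 0) :
    ∃ c, ∀ g, β g c = q g := by
  obtain ⟨k, a, b, hs, -, hmax⟩ := exists_maximal_isSymplectic hβ ⊤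
  -- The coefficients are crossed because pairing with `a i` reads off the coefficient of `b i`, and
  -- conversely; thus `c` represents `q` on the family.
  refine ⟨pairSum a b fun i => (q (b i), q (a i)), fun g => ?_⟩
  set c := pairSum a b fun i => (q (b i), q (a i)) with hc
  have hgw := hs.sub_pairSum_orthogonal hβ g
  set p := pairSum a b fun i => (β g (b i), β g (a i)) with hp
  have hw := hmax (g - p) trivial hgw
  -- The remainder is orthogonal to the family, hence in the radical, where `q` vanishes by `hq`.
  have hqw : q (g - p) = 0 := by
    rcases hrad _ fun v => hw v trivial with h | h <;> rw [h]
    · exact map_zero q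
    · exact hq
  have h1 : β g c = β p c := by
    rw [← sub_eq_zero, ← AddMonoidHom.sub_apply, ← map_sub]
    exact hw c trivial
  have h2 : q g = q p := by
    rw [← sub_eq_zero, ← map_sub]
    exact hqw
  rw [h1, h2, hp, form_pairSum, pairSum, map_sum]
  refine Finset.sum_congr rfl fun i _ => ?_
  rw [form_comm hβ (a i), form_comm hβ (b i), hc, hs.form_pairSum_left hβ, hs.form_pairSum_right,
    map_add, map_nsmul, map_nsmul, nsmul_eq_mul, nsmul_eq_mul, ZMod.natCast_zmod_val,
    ZMod.natCast_zmod_val]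

/-- The homomorphism `c ↦ c • a` from `ZMod n`, for `a` killed by `n`. -/
def zmodHom (n : ℕ) [NeZero n] (a : G) (ha : n • a = 0) : ZMod n →+ G :=
  ZMod.lift n ⟨zmultiplesHom G a, by simpa using ha⟩

theorem zmodHom_apply {n : ℕ} [NeZero n] {a : G} (ha : n • a = 0) (c : ZMod n) :
    zmodHom n a ha c = c.val • a := by
  have h : ((c.val : ℤ) : ZMod n) = c := by simp
  conv_lhs => rw [← h]
  rw [zmodHom, ZMod.lift_coe]
  exact natCast_zsmul a c.val

/-- `pairSum` as a homomorphism, for pairs of elements of order two. -/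
def pairSumHom {k : ℕ} {a b : Fin k → G} (ha : ∀ i, 2 • a i = 0) (hb : ∀ i, 2 • b i = 0) :
    (Fin k → ZMod 2 × ZMod 2) →+ G where
  toFun := pairSum a b
  map_zero' := by simp [pairSum]
  map_add' x y := by
    rw [pairSum, pairSum, pairSum, ← Finset.sum_add_distrib]
    refine Finset.sum_congr rfl fun i _ => ?_
    have h1 := map_add (zmodHom 2 (a i) (ha i)) (x i).1 (y i).1
    have h2 := map_add (zmodHom 2 (b i) (hb i)) (x i).2 (y i).2
    simp only [zmodHom_apply] at h1 h2
    rw [Pi.add_apply, Prod.fst_add, Prod.snd_add, h1, h2]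
    abel

theorem IsSymplectic.pairSum_injective (hβ : ∀ x, β x x = 0) {k : ℕ} {a b : Fin k → G}
    (hs : IsSymplectic β a b) {h : Fin k → ZMod 2 × ZMod 2}
    (h0 : ∀ i, β (pairSum a b h) (a i) = 0 ∧ β (pairSum a b h) (b i) = 0) : h = 0 := by
  funext i
  have := h0 i
  rw [hs.form_pairSum_left hβ, hs.form_pairSum_right] at this
  exact Prod.ext this.2 this.1

/-- A symplectic family of elements of order two with radical `{0, f}` gives coordinates. -/
theorem IsSymplectic.exists_addEquiv (hβ : ∀ x, β x x = 0) {f : G} (hf0 : f ≠ 0)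
    (hf : ∀ v, β f v = 0) (h2 : ∀ g : G, 2 • g = 0) {k : ℕ} {a b : Fin k → G}
    (hs : IsSymplectic β a b)
    (hmax : ∀ w, (∀ i, β w (a i) = 0 ∧ β w (b i) = 0) → w = 0 ∨ w = f) :
    ∃ α : (Fin k → ZMod 2 × ZMod 2) × ZMod 2 ≃+ G,
      ∀ h, α h = pairSum a b h.1 + h.2.val • f := by
  let α : (Fin k → ZMod 2 × ZMod 2) × ZMod 2 →+ G :=
    (pairSumHom (fun i => h2 (a i)) fun i => h2 (b i)).coprod (zmodHom 2 f (h2 f))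
  have hα : ∀ h, α h = pairSum a b h.1 + h.2.val • f := fun h => by
    rw [← zmodHom_apply (h2 f)]; rfl
  refine ⟨AddEquiv.ofBijective α ⟨(injective_iff_map_eq_zero α).2 fun h h0 => ?_, fun g => ?_⟩, hα⟩
  · rw [hα] at h0
    have hfv : ∀ v, β (pairSum a b h.1) v = 0 := fun v => by
      have := congrArg (fun x => β x v) h0
      simpa [form_val_nsmul_left, hf] using this
    have h1 : h.1 = 0 := hs.pairSum_injective hβ fun i => ⟨hfv _, hfv _⟩
    refine Prod.ext h1 ?_
    have hp : pairSum a b h.1 = 0 := by rw [h1]; simp [pairSum]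
    rw [hp, zero_add] at h0
    have : ∀ c : ZMod 2, c = 0 ∨ c = 1 := by decide
    rcases this h.2 with h | h
    · exact h
    · rw [h] at h0
      exact absurd (by simpa [ZMod.val_one] using h0) hf0
  · rcases hmax _ (hs.sub_pairSum_orthogonal hβ g) with h | h
    · exact ⟨(_, 0), by rw [hα]; simpa using (sub_eq_zero.1 h).symm⟩
    · exact ⟨(_, 1), by rw [hα]; simpa [ZMod.val_one] using (sub_eq_iff_eq_add'.1 h).symm⟩

/-- The coordinates given by a hyperbolic pair `(e, c)` with `e` of order four, together with
an orthogonal symplectic family of elements of order two. -/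
theorem IsSymplectic.exists_addEquiv_four (hβ : ∀ x, β x x = 0) {f e c : G} (hf0 : f ≠ 0)
    (hf2 : 2 • f = 0) (he : 2 • e = f) (hc : 2 • c = 0) (hec : β e c = 1)
    {k : ℕ} {a b : Fin k → G} (hs : IsSymplectic β a b)
    (h2 : ∀ i, 2 • a i = 0 ∧ 2 • b i = 0)
    (ha : ∀ i, β e (a i) = 0 ∧ β c (a i) = 0) (hb : ∀ i, β e (b i) = 0 ∧ β c (b i) = 0)
    (hmax : ∀ w, β w e = 0 → β w c = 0 → (∀ i, β w (a i) = 0 ∧ β w (b i) = 0) → w = 0 ∨ w = f) :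
    ∃ α : (ZMod 4 × ZMod 2) × (Fin k → ZMod 2 × ZMod 2) ≃+ G,
      ∀ h, α h = (h.1.1.val • e + h.1.2.val • c) + pairSum a b h.2 := by
  have he4 : 4 • e = 0 := by rw [show 4 = 2 * 2 from rfl, mul_smul, he, hf2]
  let α : (ZMod 4 × ZMod 2) × (Fin k → ZMod 2 × ZMod 2) →+ G :=
    ((zmodHom 4 e he4).coprod (zmodHom 2 c hc)).coprod
      (pairSumHom (fun i => (h2 i).1) fun i => (h2 i).2)
  have hα : ∀ h, α h = (h.1.1.val • e + h.1.2.val • c) + pairSum a b h.2 := fun h => by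
    rw [← zmodHom_apply he4, ← zmodHom_apply hc]; rfl
  have hce : β c e = 1 := by rw [form_comm hβ, hec]
  have hpe : ∀ h, β (pairSum a b h) e = 0 := fun h => by
    simp [form_pairSum, form_comm hβ (a _) e, form_comm hβ (b _) e, ha, hb]
  have hpc : ∀ h, β (pairSum a b h) c = 0 := fun h => by
    simp [form_pairSum, form_comm hβ (a _) c, form_comm hβ (b _) c, ha, hb]
  refine ⟨AddEquiv.ofBijective α ⟨(injective_iff_map_eq_zero α).2 fun h h0 => ?_, fun g => ?_⟩, hα⟩
  · obtain ⟨⟨s, t⟩, h⟩ := h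
    rw [hα] at h0
    have hv : ∀ v, (s.val : ZMod 2) * β e v + t * β c v + β (pairSum a b h) v = 0 := fun v => by
      have := congrArg (fun x => β x v) h0
      simpa [form_val_nsmul_left, nsmul_eq_mul] using this
    have h1 : h = 0 := hs.pairSum_injective hβ fun i =>
      ⟨by simpa [ha] using hv (a i), by simpa [hb] using hv (b i)⟩
    have ht : t = 0 := by simpa [hβ, hce, hpe] using hv e
    -- Pairing with `c` sees only the parity of `s`; the remaining value `s = 2` is excluded by `2 •
    -- e = f ≠ 0`.
    have hsv : (s.val : ZMod 2) = 0 := by simpa [hβ, hec, hpc] using hv c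
    subst h1 ht
    have h0' : s.val • e = 0 := by simpa [pairSum] using h0
    have hs4 : ∀ s : ZMod 4, (s.val : ZMod 2) = 0 → s = 0 ∨ s = 2 := by decide
    rcases hs4 s hsv with rfl | rfl
    · rfl
    · exact absurd (he.symm.trans h0') hf0
  · set g' := g - ((β g c).val • e + (β g e).val • c) with hg'
    have hge : β g' e = 0 := by simp [hg', hβ, hce]
    have hgc : β g' c = 0 := by simp [hg', hβ, hec]
    -- The remainder is `0` or `f = 2 • e`, so the coordinate along `e` absorbs it; this is why no
    -- separate factor for `f` is needed.
    have key : ∃ s : ZMod 4, s.val • e = (g' - pairSum a b fun i => (β g' (b i), β g' (a i))) := by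
      rcases hmax _ (by simp [hge, hpe]) (by simp [hgc, hpc]) (hs.sub_pairSum_orthogonal hβ g')
        with h | h
      · exact ⟨0, by simp [h]⟩
      · exact ⟨2, by rw [h, ← he]; rfl⟩
    obtain ⟨s, hs'⟩ := key
    obtain ⟨s', hs''⟩ : ∃ s' : ZMod 4, s'.val • e = (β g c).val • e := by
      rw [← ZMod.val_cast_of_lt (n := 4) (lt_trans (ZMod.val_lt (β g c)) (by norm_num))]
      exact ⟨_, rfl⟩
    refine ⟨((s + s', β g e), fun i => (β g' (b i), β g' (a i))), ?_⟩
    have hadd : (s + s').val • e = s.val • e + s'.val • e := by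
      simp only [← zmodHom_apply he4, map_add]
    rw [hα]
    dsimp only
    rw [hadd, hs', hs'', hg']
    abel

end Symplectic

/-! ### Homomorphisms out of matrix algebras and tensor powers. -/

section Homomorphisms

/-- Two anticommuting elements with square one define a homomorphism from `M₂(K)`. -/
theorem exists_algHom_matrix_two {K R : Type*} [Field K] [CharZero K] [Ring R] [Algebra K R]
    {x y : R} (hx : x * x = 1) (hy : y * y = 1) (hxy : x * y = -(y * x)) :
    ∃ ψ : Matrix (Fin 2) (Fin 2) K →ₐ[K] R, ψ (matA K) = x ∧ ψ (matB K) = y ∧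
      ∀ z, Commute z x → Commute z y → ∀ m, Commute z (ψ m) := by
  -- `p` plays the matrix unit `E₁₁ = (1 + A) / 2`; then `p * y`, `y - p * y = y * p` and `1 - p`
  -- play `E₁₂`, `E₂₁` and `E₂₂`.
  obtain ⟨p, hp⟩ : ∃ p : R, p = (2⁻¹ : K) • (1 + x) := ⟨_, rfl⟩
  have h2 : (2⁻¹ : K) + 2⁻¹ = 1 := by norm_num
  have hpx : p + p - 1 = x := by
    rw [hp, ← add_smul, h2, one_smul, add_sub_cancel_left]
  have hpp : p * p = p := by
    rw [hp, smul_mul_smul_comm]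
    simp only [mul_add, add_mul, mul_one, one_mul, hx]
    module
  have hyp : y * p = y - p * y := by
    rw [hp, mul_smul_comm, smul_mul_assoc]
    simp only [mul_add, add_mul, mul_one, one_mul, hxy]
    module
  have hpp' : ∀ z, p * (p * z) = p * z := fun z => by rw [← mul_assoc, hpp]
  have hyp' : ∀ z, y * (p * z) = y * z - p * (y * z) := fun z => by
    rw [← mul_assoc, hyp, sub_mul, mul_assoc]
  let ψ : Matrix (Fin 2) (Fin 2) K →ₗ[K] R :=
    { toFun := fun m => m 0 0 • p + m 0 1 • (p * y) + m 1 0 • (y - p * y) + m 1 1 • (1 - p)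
      map_add' := fun m m' => by simp only [Matrix.add_apply]; module
      map_smul' := fun c m => by
        simp only [Matrix.smul_apply, smul_eq_mul, RingHom.id_apply]; module }
  have hψ : ∀ m, ψ m =
      m 0 0 • p + m 0 1 • (p * y) + m 1 0 • (y - p * y) + m 1 1 • (1 - p) := fun _ => rfl
  refine ⟨AlgHom.ofLinearMap ψ ?_ ?_, ?_, ?_, ?_⟩
  · simp [hψ]
  · intro m m'
    simp only [hψ, Matrix.mul_apply, Fin.sum_univ_two, mul_add, add_mul, mul_sub, sub_mul,
      smul_mul_assoc, mul_smul_comm, mul_assoc, hpp, hpp', hyp, hyp', hy, mul_one, one_mul]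
    module
  · rw [AlgHom.ofLinearMap_apply, hψ, ← hpx]
    simp only [matA, Matrix.of_apply, Matrix.cons_val', Matrix.cons_val_zero, Matrix.cons_val_one,
      Matrix.cons_val_fin_one]
    module
  · rw [AlgHom.ofLinearMap_apply, hψ]
    simp [matB]
  · intro z hzx hzy m
    have hzp : Commute z p := by
      rw [hp]
      exact ((Commute.one_right z).add_right hzx).smul_right _
    rw [AlgHom.ofLinearMap_apply, hψ]
    have hpy := hzp.mul_right hzy
    exact (((hzp.smul_right _).add_right (hpy.smul_right _)).add_right
      ((hzy.sub_right hpy).smul_right _)).add_right (((Commute.one_right z).sub_right hzp).smul_right _)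

/-- Commuting images make the ordered product independent of the order: any factor can be pulled to
the front, which gives multilinearity, and products can be regrouped factor by factor, which gives
multiplicativity. -/
theorem exists_piTensorProduct_algHom {ι M R : Type*} [Fintype ι] [Ring M] [Algebra ℝ M]
    [Ring R] [Algebra ℝ R] (ψ : ι → M →ₐ[ℝ] R)
    (hc : ∀ i j, i ≠ j → ∀ x y, Commute (ψ i x) (ψ j y)) :
    ∃ Ψ : (⨂[ℝ] _ : ι, M) →ₐ[ℝ] R, ∀ (x : ι → M) (h),
      Ψ (PiTensorProduct.tprod ℝ x) = Finset.univ.noncommProd (fun i => ψ i (x i)) h := by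
  classical
  have hs : ∀ (s : Set ι) (x : ι → M),
      s.Pairwise (Function.onFun Commute fun i => ψ i (x i)) := fun _ _ _ _ _ _ h => hc _ _ h _ _
  let F := MonoidHom.noncommPiCoprod (fun i => (ψ i : M →* R)) fun _ _ h => hc _ _ h
  have hF : ∀ x, F x = Finset.univ.noncommProd (fun i => ψ i (x i)) (hs _ _) := fun _ => rfl
  have hup : ∀ (x : ι → M) (i : ι) (m : M), F (Function.update x i m) =
      ψ i m * (Finset.univ.erase i).noncommProd (fun j => ψ j (x j)) (hs _ _) := by
    intro x i m
    rw [hF, ← Finset.mul_noncommProd_erase _ (Finset.mem_univ i), Function.update_self]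
    congr 1
    refine Finset.noncommProd_congr rfl (fun j hj => ?_) _
    rw [Function.update_of_ne (Finset.ne_of_mem_erase hj)]
  let f : MultilinearMap ℝ (fun _ : ι => M) R :=
    { toFun := F
      map_update_add' := fun {d} x i m m' => by
        rw [Subsingleton.elim d (Classical.decEq ι)]
        rw [hup, hup, hup, map_add, add_mul]
      map_update_smul' := fun {d} x i c m => by
        rw [Subsingleton.elim d (Classical.decEq ι)]
        rw [hup, hup, map_smul, smul_mul_assoc] }
  refine ⟨PiTensorProduct.liftAlgHom f (map_one F) (map_mul F), fun x _ => ?_⟩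
  rw [PiTensorProduct.liftAlgHom_apply, PiTensorProduct.lift.tprod]
  exact hF x

theorem noncommProd_mem_graded {ι G R : Type*} [AddCommMonoid G] [Ring R] [Algebra ℝ R]
    (𝒜 : G → Submodule ℝ R) [SetLike.GradedMonoid 𝒜] (s : Finset ι) (f : ι → R) (d : ι → G)
    (hc) (h : ∀ i ∈ s, f i ∈ 𝒜 (d i)) : s.noncommProd f hc ∈ 𝒜 (∑ i ∈ s, d i) := by
  classical
  induction s using Finset.induction_on with
  | empty => simpa using SetLike.GradedOne.one_mem
  | insert i s hi ih =>
    rw [Finset.noncommProd_insert_of_notMem _ _ _ _ hi, Finset.sum_insert hi]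
    exact SetLike.GradedMul.mul_mem (h i (Finset.mem_insert_self _ _))
      (ih _ fun j hj => h j (Finset.mem_insert_of_mem hj))

end Homomorphisms

/-! ### Bases closed under multiplication up to scalars, and the gradings they define. -/

section TwistedBases

/-- A family of homogeneous units, with `1` in degree `0`, closed under multiplication
up to scalars. -/
structure IsTwisted {H S : Type*} [AddGroup H] [Semiring S] [Algebra ℝ S] (y : H → S) : Prop where
  zero : y 0 = 1
  mul : ∀ g h, ∃ c : ℝ, y g * y h = c • y (g + h)
  unit : ∀ g, IsUnit (y g)

variable {G H R S : Type*} [AddGroup G] [AddGroup H] [Ring R] [Algebra ℝ R] [Ring S] [Algebra ℝ S]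

theorem IsTwisted.tensor {x : G → R} {y : H → S} (hx : IsTwisted x) (hy : IsTwisted y) :
    IsTwisted fun p : G × H => x p.1 ⊗ₜ[ℝ] y p.2 where
  zero := by simp [hx.zero, hy.zero, Algebra.TensorProduct.one_def]
  mul p q := by
    obtain ⟨c, hc⟩ := hx.mul p.1 q.1
    obtain ⟨d, hd⟩ := hy.mul p.2 q.2
    exact ⟨c * d, by rw [Algebra.TensorProduct.tmul_mul_tmul, hc, hd, TensorProduct.smul_tmul_smul]; rfl⟩
  unit p := by
    have h1 := (hx.unit p.1).map (Algebra.TensorProduct.includeLeft : R →ₐ[ℝ] R ⊗[ℝ] S)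
    have h2 := (hy.unit p.2).map (Algebra.TensorProduct.includeRight : S →ₐ[ℝ] R ⊗[ℝ] S)
    simpa using h1.mul h2

theorem IsTwisted.piTensor {ι : Type*} [Fintype ι] {x : G → R} (hx : IsTwisted x) :
    IsTwisted fun g : ι → G => PiTensorProduct.tprod ℝ fun i => x (g i) where
  zero := by simp only [Pi.zero_apply, hx.zero]; rfl
  mul p q := by
    choose c hc using fun i => hx.mul (p i) (q i)
    refine ⟨∏ i, c i, ?_⟩
    rw [PiTensorProduct.tprod_mul_tprod, ← MultilinearMap.map_smul_univ]
    exact congrArg _ (funext hc)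
  unit g := (Pi.isUnit_iff.2 fun i => hx.unit (g i)).map (PiTensorProduct.tprodMonoidHom ℝ)

theorem IsTwisted.map {x : H → S} (hx : IsTwisted x) (e : S →ₐ[ℝ] R) : IsTwisted fun h => e (x h) where
  zero := by rw [hx.zero, map_one]
  mul p q := by
    obtain ⟨c, hc⟩ := hx.mul p q
    exact ⟨c, by rw [← map_mul, hc, map_smul]⟩
  unit h := (hx.unit h).map e

/-- Exponents add as natural numbers, and each reduction by `N` costs a factor `r`. -/
theorem pow_zmod_mul_pow {N : ℕ} [NeZero N] {x : R} {r : ℝ} (hx : x ^ N = r • 1) (a b : ZMod N) :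
    ∃ c : ℝ, x ^ a.val * x ^ b.val = c • x ^ (a + b).val := by
  refine ⟨r ^ ((a.val + b.val) / N), ?_⟩
  rw [← pow_add, ZMod.val_add]
  conv_lhs => rw [← Nat.mod_add_div (a.val + b.val) N, pow_add, pow_mul, hx, smul_pow, one_pow]
  rw [mul_smul_comm, mul_one]

theorem pow_mul_pow_of_anticomm {x y : R} (h : x * y = -(y * x)) (a b : ℕ) :
    ∃ c : ℝ, y ^ b * x ^ a = c • (x ^ a * y ^ b) := by
  have h1 : ∃ c : ℝ, y * x ^ a = c • (x ^ a * y) := by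
    induction a with
    | zero => exact ⟨1, by simp⟩
    | succ a ih =>
      obtain ⟨c, hc⟩ := ih
      refine ⟨-c, ?_⟩
      rw [pow_succ, ← mul_assoc, hc, smul_mul_assoc, mul_assoc, mul_assoc, h, mul_neg, neg_smul,
        smul_neg, neg_neg]
  obtain ⟨c, hc⟩ := h1
  induction b with
  | zero => exact ⟨1, by simp⟩
  | succ b ih =>
    obtain ⟨d, hd⟩ := ih
    refine ⟨c * d, ?_⟩
    rw [pow_succ, mul_assoc, hc, mul_smul_comm, ← mul_assoc, hd, smul_mul_assoc, mul_assoc, smul_smul]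

theorem isTwisted_pow {N : ℕ} [NeZero N] {x : R} {r : ℝ} (hx : x ^ N = r • 1) (hu : IsUnit x) :
    IsTwisted fun g : ZMod N => x ^ g.val where
  zero := by simp
  mul g h := pow_zmod_mul_pow hx g h
  unit g := hu.pow _

theorem isTwisted_pow_mul_pow {N M : ℕ} [NeZero N] [NeZero M] {x y : R} {r s : ℝ}
    (hx : x ^ N = r • 1) (hy : y ^ M = s • 1) (hux : IsUnit x) (huy : IsUnit y)
    (h : x * y = -(y * x)) :
    IsTwisted fun g : ZMod N × ZMod M => x ^ g.1.val * y ^ g.2.val where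
  zero := by simp
  mul g g' := by
    obtain ⟨c, hc⟩ := pow_zmod_mul_pow hx g.1 g'.1
    obtain ⟨d, hd⟩ := pow_zmod_mul_pow hy g.2 g'.2
    obtain ⟨e, he⟩ := pow_mul_pow_of_anticomm h g'.1.val g.2.val
    refine ⟨e * (d * c), ?_⟩
    calc x ^ g.1.val * y ^ g.2.val * (x ^ g'.1.val * y ^ g'.2.val)
        = x ^ g.1.val * (y ^ g.2.val * x ^ g'.1.val) * y ^ g'.2.val := by simp only [mul_assoc]
      _ = e • ((x ^ g.1.val * x ^ g'.1.val) * (y ^ g.2.val * y ^ g'.2.val)) := by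
          rw [he]; simp only [mul_assoc, mul_smul_comm, smul_mul_assoc]
      _ = _ := by rw [hc, hd]; simp only [mul_smul_comm, smul_mul_assoc, smul_smul]; rfl
  unit g := (hux.pow _).mul (huy.pow _)

/-- The grading by the lines spanned by a basis which is closed under multiplication. -/
theorem IsTwisted.exists_gradedAlgebra [DecidableEq H] (y : Module.Basis H ℝ S) (hy : IsTwisted y) :
    ∃ _ : GradedAlgebra fun h => Submodule.span ℝ {y h},
      IsDivisionGrading (fun h => Submodule.span ℝ {y h}) ∧
        ∀ h, Module.finrank ℝ (Submodule.span ℝ {y h}) = 1 := by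
  have hint : DirectSum.IsInternal fun h => Submodule.span ℝ {y h} := by
    refine DirectSum.isInternal_submodule_of_iSupIndep_of_iSup_eq_top
      y.linearIndependent.iSupIndep_span_singleton ?_
    rw [← Submodule.span_range_eq_iSup, y.span_eq]
  refine ⟨{ hint.chooseDecomposition with
    one_mem := by rw [← hy.zero]; exact Submodule.mem_span_singleton_self _
    mul_mem := fun {g h} a b ha hb => ?_ }, fun g a ha h0 => ?_, fun h => ?_⟩
  · obtain ⟨r, rfl⟩ := Submodule.mem_span_singleton.1 ha
    obtain ⟨s, rfl⟩ := Submodule.mem_span_singleton.1 hb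
    obtain ⟨c, hc⟩ := hy.mul g h
    rw [smul_mul_smul_comm, hc]
    exact Submodule.smul_mem _ _ (Submodule.smul_mem _ _ (Submodule.mem_span_singleton_self _))
  · obtain ⟨r, rfl⟩ := Submodule.mem_span_singleton.1 ha
    have hr : r ≠ 0 := by rintro rfl; simp at h0
    exact (hy.unit g).smul (Units.mk0 r hr)
  · exact finrank_span_singleton (y.ne_zero h)

/-- A homomorphism which carries a twisted basis to nonzero homogeneous elements, along an
isomorphism of the grading groups, is a weak isomorphism. -/
theorem IsTwisted.weaklyIsomorphic [DecidableEq G] [Nontrivial R] {y : H → S}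
    (b : Module.Basis H ℝ S) (hb : ∀ h, b h = y h) (hy : IsTwisted y)
    (𝒜 : G → Submodule ℝ R) [GradedAlgebra 𝒜] (h1 : ∀ g, Module.finrank ℝ (𝒜 g) = 1)
    (φ : S →ₐ[ℝ] R) (α : H ≃+ G) (hφ : ∀ h, φ (y h) ∈ 𝒜 (α h)) :
    WeaklyIsomorphic 𝒜 fun h => Submodule.span ℝ {y h} := by
  have hne : ∀ h, φ (y h) ≠ 0 := fun h => ((hy.unit h).map φ).ne_zero
  -- A nonzero vector spans a one-dimensional component. Independence of the components then gives
  -- injectivity of `φ`, and their sum being everything gives surjectivity.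
  have hspan : ∀ h, 𝒜 (α h) = Submodule.span ℝ {φ (y h)} := fun h => by
    have hfin : Module.Finite ℝ (𝒜 (α h)) := Module.finite_of_finrank_eq_succ (h1 _)
    refine (Submodule.eq_of_le_of_finrank_eq ((Submodule.span_singleton_le_iff_mem _ _).2 (hφ h))
      ?_).symm
    rw [h1, finrank_span_singleton (hne h)]
  have hint := DirectSum.Decomposition.isInternal 𝒜
  have hli : LinearIndependent ℝ fun h => φ (y h) := by
    refine iSupIndep.linearIndependent (fun h => 𝒜 (α h))
      (hint.submodule_iSupIndep.comp α.injective) hφ hne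
  have hbij : Function.Bijective φ := by
    constructor
    · refine (injective_iff_map_eq_zero φ).2 fun s hs => ?_
      have hli' : LinearIndependent ℝ fun h => φ (b h) := by simpa only [hb] using hli
      rw [← b.linearCombination_repr s] at hs ⊢
      have := linearIndependent_iff.1 hli' (b.repr s) (by
        rw [← hs, Finsupp.linearCombination_apply, Finsupp.linearCombination_apply]
        simp only [Finsupp.sum, map_sum, map_smul])
      rw [this, map_zero]
    · have : LinearMap.range φ.toLinearMap = ⊤ := by
        rw [eq_top_iff, ← hint.submodule_iSup_eq_top]
        refine iSup_le fun g => ?_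
        obtain ⟨h, rfl⟩ := α.surjective g
        rw [hspan, Submodule.span_singleton_le_iff_mem]
        exact ⟨y h, rfl⟩
      exact LinearMap.range_eq_top.1 this
  refine ⟨(AlgEquiv.ofBijective φ hbij).symm, α.symm, fun g => ?_⟩
  obtain ⟨h, rfl⟩ := α.surjective g
  rw [hspan, Submodule.map_span, Set.image_singleton, α.symm_apply_apply]
  congr 2
  exact (AlgEquiv.ofBijective φ hbij).symm_apply_apply (y h)

end TwistedBases

/-! ### Homogeneous bases of the model algebras. -/

section StandardBases

theorem sum_zmod_two {M : Type*} [AddCommMonoid M] (f : ZMod 2 → M) : ∑ i, f i = f 0 + f 1 :=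
  Fin.sum_univ_two f

theorem sum_zmod_four {M : Type*} [AddCommMonoid M] (f : ZMod 4 → M) :
    ∑ i, f i = f 0 + f 1 + f 2 + f 3 :=
  Fin.sum_univ_four f

variable (K : Type*) [CommRing K]

theorem matA_mul_matA : matA K * matA K = 1 := by
  simp [matA, Matrix.one_fin_two]

theorem matB_mul_matB : matB K * matB K = 1 := by
  simp [matB, Matrix.one_fin_two]

theorem matC_mul_matC : matC K * matC K = -1 := by
  simp [matC, Matrix.one_fin_two]

theorem matA_mul_matB : matA K * matB K = -(matB K * matA K) := by
  simp [matA, matB]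

theorem matA_mul_matC_anticomm : matA K * matC K = -(matC K * matA K) := by
  simp [matA, matC]

theorem matA_mul_matB_eq : matA K * matB K = matC K := by
  simp [matA, matB, matC]

theorem omega_mul_omega : omega * omega = Complex.I := by
  have h : (Real.sqrt 2 : ℂ) * (Real.sqrt 2 : ℂ) = 2 := by
    rw [← Complex.ofReal_mul, Real.mul_self_sqrt (by norm_num)]; norm_num
  rw [omega, div_mul_div_comm, h]
  linear_combination (1 / 2 : ℂ) * Complex.I_mul_I

theorem omega_ne_zero : omega ≠ 0 := by
  intro h
  have := omega_mul_omega
  rw [h, mul_zero] at this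
  exact Complex.I_ne_zero this.symm

theorem omega_matA_sq : (omega • matA ℂ) * (omega • matA ℂ) = Complex.I • 1 := by
  rw [smul_mul_smul_comm, matA_mul_matA, omega_mul_omega]

theorem omega_matA_pow_four : (omega • matA ℂ) ^ 4 = (-1 : ℝ) • 1 := by
  rw [show 4 = 2 * 2 from rfl, pow_mul, pow_two (omega • matA ℂ), omega_matA_sq, pow_two, smul_mul_smul_comm,
    Complex.I_mul_I]
  simp

theorem isTwisted_C2 : IsTwisted fun g : ZMod 2 => Complex.I ^ g.val :=
  isTwisted_pow (r := -1) (by simp) (isUnit_iff_ne_zero.2 Complex.I_ne_zero)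

theorem isTwisted_M24 :
    IsTwisted fun g : ZMod 2 × ZMod 2 => matA ℝ ^ g.1.val * matB ℝ ^ g.2.val :=
  isTwisted_pow_mul_pow (r := 1) (s := 1) (by rw [pow_two, matA_mul_matA, one_smul])
    (by rw [pow_two, matB_mul_matB, one_smul]) (.of_mul_eq_one _ (matA_mul_matA ℝ))
    (.of_mul_eq_one _ (matB_mul_matB ℝ)) (matA_mul_matB ℝ)

theorem isTwisted_M28 :
    IsTwisted fun g : ZMod 4 × ZMod 2 => (omega • matA ℂ) ^ g.1.val * matC ℂ ^ g.2.val := by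
  refine isTwisted_pow_mul_pow (r := -1) (s := -1) omega_matA_pow_four
    (by rw [pow_two, matC_mul_matC, neg_smul, one_smul]) ?_ ?_ ?_
  · exact (IsUnit.of_mul_eq_one _ (matA_mul_matA ℂ)).smul (Units.mk0 omega omega_ne_zero)
  · exact .of_mul_eq_one (-matC ℂ) (by rw [mul_neg, matC_mul_matC, neg_neg])
  · rw [smul_mul_assoc, matA_mul_matC_anticomm, smul_neg, mul_smul_comm]

theorem exists_basis_C2 : ∃ b : Module.Basis (ZMod 2) ℝ ℂ, ∀ g, b g = Complex.I ^ g.val := by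
  have hli : LinearIndependent ℝ fun g : ZMod 2 => Complex.I ^ g.val := by
    refine Fintype.linearIndependent_iff.2 fun c hc => ?_
    rw [sum_zmod_two, Complex.ext_iff] at hc
    simp [ZMod.val_one] at hc
    have h2 : ∀ i : ZMod 2, i = 0 ∨ i = 1 := by decide
    intro i
    rcases h2 i with rfl | rfl
    exacts [hc.1, hc.2]
  exact ⟨basisOfLinearIndependentOfCardEqFinrank hli (by simp), fun g => by simp⟩

theorem exists_basis_M24 : ∃ b : Module.Basis (ZMod 2 × ZMod 2) ℝ (Matrix (Fin 2) (Fin 2) ℝ),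
    ∀ g, b g = matA ℝ ^ g.1.val * matB ℝ ^ g.2.val := by
  have hli : LinearIndependent ℝ
      fun g : ZMod 2 × ZMod 2 => matA ℝ ^ g.1.val * matB ℝ ^ g.2.val := by
    refine Fintype.linearIndependent_iff.2 fun c hc => ?_
    rw [Fintype.sum_prod_type] at hc
    simp only [sum_zmod_two, ZMod.val_zero, ZMod.val_one, pow_zero, pow_one, one_mul, mul_one] at hc
    have h00 := congrFun (congrFun hc 0) 0
    have h01 := congrFun (congrFun hc 0) 1
    have h10 := congrFun (congrFun hc 1) 0
    have h11 := congrFun (congrFun hc 1) 1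
    simp [matA, matB] at h00 h01 h10 h11
    have h2 : ∀ i : ZMod 2, i = 0 ∨ i = 1 := by decide
    rintro ⟨i, j⟩
    rcases h2 i with rfl | rfl <;> rcases h2 j with rfl | rfl <;> linarith
  exact ⟨basisOfLinearIndependentOfCardEqFinrank hli (by simp [Module.finrank_matrix]),
    fun g => by simp⟩

theorem exists_basis_M28 : ∃ b : Module.Basis (ZMod 4 × ZMod 2) ℝ (Matrix (Fin 2) (Fin 2) ℂ),
    ∀ g, b g = (omega • matA ℂ) ^ g.1.val * matC ℂ ^ g.2.val := by
  have hli : LinearIndependent ℝ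
      fun g : ZMod 4 × ZMod 2 => (omega • matA ℂ) ^ g.1.val * matC ℂ ^ g.2.val := by
    refine Fintype.linearIndependent_iff.2 fun c hc => ?_
    rw [Fintype.sum_prod_type] at hc
    have v1 : (1 : ZMod 4).val = 1 := rfl
    have v2 : (2 : ZMod 4).val = 2 := rfl
    have v3 : (3 : ZMod 4).val = 3 := rfl
    simp only [sum_zmod_two, sum_zmod_four, ZMod.val_zero, ZMod.val_one, pow_zero, one_mul,
      mul_one, v1, v2, v3, pow_succ, omega_matA_sq] at hc
    have h00 := congrFun (congrFun hc 0) 0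
    have h01 := congrFun (congrFun hc 0) 1
    have h10 := congrFun (congrFun hc 1) 0
    have h11 := congrFun (congrFun hc 1) 1
    simp [matA, matC] at h00 h01 h10 h11
    have key : ∀ a b : ℝ, (a : ℂ) + b * Complex.I = 0 → a = 0 ∧ b = 0 := fun a b h => by
      simpa [Complex.ext_iff] using h
    have key' : ∀ a b : ℝ, ((a : ℂ) + b * Complex.I) * omega = 0 → a = 0 ∧ b = 0 := fun a b h =>
      key a b ((mul_eq_zero.1 h).resolve_right omega_ne_zero)
    -- Sum and difference of the diagonal entries separate the `I` and `A` parts, those of the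
    -- off-diagonal entries the `B` and `C` parts; within each, real and imaginary parts remain,
    -- after cancelling `ω` where it occurs.
    have e0 := key (c (0, 0)) (c (2, 0)) (by linear_combination (h00 + h11) / 2)
    have e1 := key' (c (1, 0)) (c (3, 0)) (by linear_combination (h00 - h11) / 2)
    have e2 := key (c (0, 1)) (c (2, 1)) (by linear_combination (h01 - h10) / 2)
    have e3 := key' (c (1, 1)) (c (3, 1)) (by linear_combination (h01 + h10) / 2)
    have h2 : ∀ i : ZMod 2, i = 0 ∨ i = 1 := by decide
    have h4 : ∀ i : ZMod 4, i = 0 ∨ i = 1 ∨ i = 2 ∨ i = 3 := by decide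
    rintro ⟨i, j⟩
    rcases h4 i with rfl | rfl | rfl | rfl <;> rcases h2 j with rfl | rfl
    exacts [e0.1, e2.1, e1.1, e3.1, e0.2, e2.2, e1.2, e3.2]
  exact ⟨basisOfLinearIndependentOfCardEqFinrank hli (by simp [Module.finrank_matrix]),
    fun g => by simp⟩

theorem tensorGrading_span {G H R S : Type*} [Semiring R] [Algebra ℝ R] [Semiring S] [Algebra ℝ S]
    (x : G → R) (y : H → S) :
    tensorGrading (fun g => Submodule.span ℝ {x g}) (fun h => Submodule.span ℝ {y h}) =
      fun p => Submodule.span ℝ {x p.1 ⊗ₜ[ℝ] y p.2} := by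
  funext p
  simp only [tensorGrading, Submodule.map₂_span_span, Set.image2_singleton, TensorProduct.mk_apply]

theorem tensorPowerGrading_span {G R : Type*} [Semiring R] [Algebra ℝ R] (x : G → R) (k : ℕ) :
    tensorPowerGrading (fun g => Submodule.span ℝ {x g}) k =
      fun g => Submodule.span ℝ {PiTensorProduct.tprod ℝ fun i => x (g i)} := by
  funext g
  refine le_antisymm (Submodule.span_le.2 ?_) ((Submodule.span_singleton_le_iff_mem _ _).2 ?_)
  · rintro _ ⟨z, hz, rfl⟩
    choose c hc using fun i => Submodule.mem_span_singleton.1 (hz i)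
    obtain rfl : (fun i => c i • x (g i)) = z := funext hc
    rw [MultilinearMap.map_smul_univ]
    exact Submodule.smul_mem _ _ (Submodule.mem_span_singleton_self _)
  · exact Submodule.subset_span ⟨_, fun i => Submodule.mem_span_singleton_self _, rfl⟩

/-- The homogeneous basis of `(M₂^{(4)})^{⊗ k}`. -/
def powerBasis (k : ℕ) (g : Fin k → ZMod 2 × ZMod 2) :
    ⨂[ℝ] _ : Fin k, Matrix (Fin 2) (Fin 2) ℝ :=
  PiTensorProduct.tprod ℝ fun i => matA ℝ ^ (g i).1.val * matB ℝ ^ (g i).2.val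

theorem isTwisted_powerBasis (k : ℕ) : IsTwisted (powerBasis k) := isTwisted_M24.piTensor

theorem exists_basis_powerBasis (k : ℕ) :
    ∃ b : Module.Basis (Fin k → ZMod 2 × ZMod 2) ℝ (⨂[ℝ] _ : Fin k, Matrix (Fin 2) (Fin 2) ℝ),
      ∀ g, b g = powerBasis k g := by
  obtain ⟨b, hb⟩ := exists_basis_M24
  exact ⟨Basis.piTensorProduct fun _ => b, fun g => by
    rw [Basis.piTensorProduct_apply, powerBasis]; simp only [hb]⟩

/-- The homogeneous basis of `(M₂^{(4)})^{⊗ k} ⊗ ℂ^{(2)}`. -/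
def basisOne (k : ℕ) (p : (Fin k → ZMod 2 × ZMod 2) × ZMod 2) : AlgOne k :=
  powerBasis k p.1 ⊗ₜ[ℝ] (Complex.I ^ p.2.val)

/-- The homogeneous basis of `M₂^{(8)} ⊗ (M₂^{(4)})^{⊗ m}`. -/
def basisTwo (m : ℕ) (p : (ZMod 4 × ZMod 2) × (Fin m → ZMod 2 × ZMod 2)) : AlgTwo m :=
  ((omega • matA ℂ) ^ p.1.1.val * matC ℂ ^ p.1.2.val) ⊗ₜ[ℝ] powerBasis m p.2

theorem isTwisted_basisOne (k : ℕ) : IsTwisted (basisOne k) :=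
  (isTwisted_powerBasis k).tensor isTwisted_C2

theorem isTwisted_basisTwo (m : ℕ) : IsTwisted (basisTwo m) :=
  isTwisted_M28.tensor (isTwisted_powerBasis m)

theorem exists_basis_basisOne (k : ℕ) :
    ∃ b : Module.Basis ((Fin k → ZMod 2 × ZMod 2) × ZMod 2) ℝ (AlgOne k),
      ∀ h, b h = basisOne k h := by
  obtain ⟨b, hb⟩ := exists_basis_powerBasis k
  obtain ⟨b', hb'⟩ := exists_basis_C2
  exact ⟨b.tensorProduct b', fun h => by rw [Module.Basis.tensorProduct_apply', hb, hb', basisOne]⟩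

theorem exists_basis_basisTwo (m : ℕ) :
    ∃ b : Module.Basis ((ZMod 4 × ZMod 2) × (Fin m → ZMod 2 × ZMod 2)) ℝ (AlgTwo m),
      ∀ h, b h = basisTwo m h := by
  obtain ⟨b, hb⟩ := exists_basis_powerBasis m
  obtain ⟨b', hb'⟩ := exists_basis_M28
  exact ⟨b'.tensorProduct b, fun h => by rw [Module.Basis.tensorProduct_apply', hb, hb', basisTwo]⟩

theorem typeOne_eq_span (k : ℕ) : typeOne k = fun h => Submodule.span ℝ {basisOne k h} := by
  unfold typeOne gradM24 gradC2
  rw [tensorPowerGrading_span, tensorGrading_span]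
  rfl

theorem typeTwo_eq_span (m : ℕ) : typeTwo m = fun h => Submodule.span ℝ {basisTwo m h} := by
  unfold typeTwo gradM24 gradM28
  rw [tensorPowerGrading_span, tensorGrading_span]
  rfl

end StandardBases

/-! ### The model algebras as complex matrix algebras. -/

section MatrixModels

/-- Tensor powers of matrix algebras are matrix algebras. -/
theorem nonempty_piTensorProduct_matrix_algEquiv (k : ℕ) :
    Nonempty ((⨂[ℝ] _ : Fin k, Matrix (Fin 2) (Fin 2) ℝ) ≃ₐ[ℝ]
      Matrix (Fin k → Fin 2) (Fin k → Fin 2) ℝ) := by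
  have hup : ∀ (x : Fin k → Matrix (Fin 2) (Fin 2) ℝ) (i : Fin k) (m : Matrix (Fin 2) (Fin 2) ℝ)
      (p q : Fin k → Fin 2), ∏ j, Function.update x i m j (p j) (q j) =
        m (p i) (q i) * ∏ j ∈ Finset.univ.erase i, x j (p j) (q j) := fun x i m p q => by
    rw [← Finset.mul_prod_erase _ _ (Finset.mem_univ i)]
    refine congrArg₂ _ (congrArg (fun M : Matrix (Fin 2) (Fin 2) ℝ => M (p i) (q i))
      (Function.update_self ..)) (Finset.prod_congr rfl fun j hj => ?_)
    exact congrArg (fun M : Matrix (Fin 2) (Fin 2) ℝ => M (p j) (q j))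
      (Function.update_of_ne (Finset.ne_of_mem_erase hj) ..)
  -- This is the iterated Kronecker product. Its values include all matrix units, and both sides
  -- have dimension `4 ^ k`, so surjectivity suffices.
  let f : MultilinearMap ℝ (fun _ : Fin k => Matrix (Fin 2) (Fin 2) ℝ)
      (Matrix (Fin k → Fin 2) (Fin k → Fin 2) ℝ) :=
    { toFun := fun x => Matrix.of fun p q => ∏ i, x i (p i) (q i)
      map_update_add' := fun {d} x i m m' => by
        rw [Subsingleton.elim d (instDecidableEqFin k)]
        ext p q
        simp only [Matrix.of_apply, Matrix.add_apply, hup, add_mul]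
      map_update_smul' := fun {d} x i c m => by
        rw [Subsingleton.elim d (instDecidableEqFin k)]
        ext p q
        simp only [Matrix.of_apply, Matrix.smul_apply, hup, smul_eq_mul, mul_assoc] }
  have hf : ∀ x p q, f x p q = ∏ i, x i (p i) (q i) := fun _ _ _ => rfl
  let φ := PiTensorProduct.liftAlgHom f
    (by
      ext p q
      rw [hf, Matrix.one_apply]
      simp only [Pi.one_apply, Matrix.one_apply, Finset.prod_ite_zero, Finset.prod_const_one,
        Finset.mem_univ, true_implies, funext_iff])
    (fun x y => by
      ext p q
      simp only [hf, Matrix.mul_apply, Pi.mul_apply, ← Finset.prod_mul_distrib]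
      rw [Finset.prod_univ_sum, Fintype.piFinset_univ])
  have hφ : ∀ x, φ (PiTensorProduct.tprod ℝ x) = f x := fun x => by
    simp [φ, PiTensorProduct.liftAlgHom_apply]
  have hsurj : Function.Surjective φ.toLinearMap := by
    rw [← LinearMap.range_eq_top, eq_top_iff]
    intro m _
    rw [Matrix.matrix_eq_sum_single m]
    refine Submodule.sum_mem _ fun p _ => Submodule.sum_mem _ fun q _ => ?_
    rw [show Matrix.single p q (m p q) = m p q • Matrix.single p q (1 : ℝ) by simp]
    refine Submodule.smul_mem _ _ ⟨PiTensorProduct.tprod ℝ fun i => Matrix.single (p i) (q i) 1, ?_⟩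
    rw [AlgHom.toLinearMap_apply, hφ]
    ext p' q'
    rw [hf]
    simp only [Matrix.single_apply, Finset.prod_ite_zero, Finset.prod_const_one, Finset.mem_univ,
      true_implies, funext_iff, forall_and]
  obtain ⟨b, -⟩ := exists_basis_powerBasis k
  have hfin := b.finiteDimensional_of_finite
  have hrank : Module.finrank ℝ (⨂[ℝ] _ : Fin k, Matrix (Fin 2) (Fin 2) ℝ) =
      Module.finrank ℝ (Matrix (Fin k → Fin 2) (Fin k → Fin 2) ℝ) := by
    rw [Module.finrank_eq_card_basis b]
    simp [Module.finrank_matrix, ← mul_pow]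
  exact ⟨AlgEquiv.ofBijective φ
    ⟨(LinearMap.injective_iff_surjective_of_finrank_eq_finrank hrank).2 hsurj, hsurj⟩⟩

theorem nonempty_algOne_algEquiv (k : ℕ) :
    Nonempty (AlgOne k ≃ₐ[ℝ] Matrix (Fin (2 ^ k)) (Fin (2 ^ k)) ℂ) := by
  obtain ⟨e⟩ := nonempty_piTensorProduct_matrix_algEquiv k
  have hcard : Fintype.card (Fin k → Fin 2) = Fintype.card (Fin (2 ^ k)) := by simp
  exact ⟨(Algebra.TensorProduct.congr e .refl).trans <|
    (Algebra.TensorProduct.comm ℝ _ ℂ).trans <|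
      (matrixEquivTensor (Fin k → Fin 2) ℝ ℂ).symm.trans <|
        Matrix.reindexAlgEquiv ℝ ℂ (Fintype.equivOfCardEq hcard)⟩

theorem nonempty_algTwo_algEquiv (m : ℕ) :
    Nonempty (AlgTwo m ≃ₐ[ℝ] Matrix (Fin (2 ^ (m + 1))) (Fin (2 ^ (m + 1))) ℂ) := by
  obtain ⟨e⟩ := nonempty_piTensorProduct_matrix_algEquiv m
  have hcard : Fintype.card ((Fin m → Fin 2) × Fin 2) = Fintype.card (Fin (2 ^ (m + 1))) := by
    simp [pow_succ]
  exact ⟨(Algebra.TensorProduct.congr .refl e).trans <|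
      (matrixEquivTensor (Fin m → Fin 2) ℝ (Matrix (Fin 2) (Fin 2) ℂ)).symm.trans <|
        (Matrix.compAlgEquiv (Fin m → Fin 2) (Fin 2) ℂ ℝ).trans <|
        Matrix.reindexAlgEquiv ℝ ℂ (Fintype.equivOfCardEq hcard)⟩

/-- A twisted basis is transported to a division grading by an isomorphism of algebras. -/
theorem IsTwisted.exists_weaklyIsomorphic {H R S : Type*} [AddGroup H] [DecidableEq H] [Ring R]
    [Algebra ℝ R] [Ring S] [Algebra ℝ S] {y : H → S} (hy : IsTwisted y)
    (b : Module.Basis H ℝ S) (hb : ∀ h, b h = y h) (e : S ≃ₐ[ℝ] R) :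
    ∃ (𝒜 : H → Submodule ℝ R) (_ : GradedAlgebra 𝒜), IsDivisionGrading 𝒜 ∧
      (∀ h, Module.finrank ℝ (𝒜 h) = 1) ∧
        WeaklyIsomorphic 𝒜 fun h => Submodule.span ℝ {y h} := by
  have hb' : ∀ h, b.map e.toLinearEquiv h = e (y h) := fun h => by simp [hb]
  have hy' : IsTwisted (b.map e.toLinearEquiv) := by
    rw [funext hb']
    exact hy.map e.toAlgHom
  obtain ⟨hg, hdiv, hrank⟩ := hy'.exists_gradedAlgebra
  refine ⟨_, hg, hdiv, hrank, e.symm, AddEquiv.refl H, fun h => ?_⟩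
  rw [Submodule.map_span, Set.image_singleton, hb']
  congr 2
  exact e.symm_apply_apply (y h)

end MatrixModels

/-! ### The commutation form and the degree of `i`. -/

section ComplexMatrixGradings

variable {n : ℕ}

/-- The commutation form `β` of a division grading with one-dimensional components on `M_n(ℂ)`,
together with the degree `f` of the imaginary unit. -/
structure IsCommutationForm {G : Type*} [AddCommGroup G]
    (𝒜 : G → Submodule ℝ (Matrix (Fin n) (Fin n) ℂ))
    (β : G →+ G →+ ZMod 2) (f : G) : Prop where
  alt : ∀ g, β g g = 0
  commute : ∀ {g h x y}, x ∈ 𝒜 g → y ∈ 𝒜 h → β g h = 0 → Commute x y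
  anticommute : ∀ {g h x y}, x ∈ 𝒜 g → y ∈ 𝒜 h → β g h = 1 → x * y = -(y * x)
  radical : ∀ g, (∀ h, β g h = 0) → g = 0 ∨ g = f
  ne_zero : f ≠ 0
  form_eq_zero : ∀ h, β f h = 0
  order_two : 2 • f = 0
  I_mem : Complex.I • 1 ∈ 𝒜 f
  square : ∀ {g u}, u ∈ 𝒜 (g + g) → u ≠ 0 →
    ∃ x ∈ 𝒜 g, ∃ r : ℝ, r ≠ 0 ∧ x * x = r • u

theorem nontrivial_of_finrank {G : Type*} [Zero G]
    {𝒜 : G → Submodule ℝ (Matrix (Fin n) (Fin n) ℂ)}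
    (h1 : ∀ g, Module.finrank ℝ (𝒜 g) = 1) :
    Nontrivial (Matrix (Fin n) (Fin n) ℂ) := by
  by_contra h
  rw [not_nontrivial_iff_subsingleton] at h
  have := h1 0
  rw [Module.finrank_zero_of_subsingleton] at this
  exact zero_ne_one this

theorem exists_mem_ne_zero {G : Type*} {𝒜 : G → Submodule ℝ (Matrix (Fin n) (Fin n) ℂ)}
    (h1 : ∀ g, Module.finrank ℝ (𝒜 g) = 1) (g : G) :
    ∃ x ∈ 𝒜 g, x ≠ 0 := by
  have : 𝒜 g ≠ ⊥ := by
    intro h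
    have := h1 g
    rw [h, finrank_bot] at this
    exact zero_ne_one this
  exact Submodule.exists_mem_ne_zero_of_ne_bot this

theorem exists_eq_smul {G : Type*} {𝒜 : G → Submodule ℝ (Matrix (Fin n) (Fin n) ℂ)}
    (h1 : ∀ g, Module.finrank ℝ (𝒜 g) = 1) {g : G}
    {x y : Matrix (Fin n) (Fin n) ℂ} (hx : x ∈ 𝒜 g) (hy : y ∈ 𝒜 g) (hy0 : y ≠ 0) :
    ∃ r : ℝ, x = r • y := by
  obtain ⟨r, hr⟩ := (finrank_eq_one_iff_of_nonzero' (⟨y, hy⟩ : 𝒜 g)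
    (fun h => hy0 (congrArg Subtype.val h))).1 (h1 g) ⟨x, hx⟩
  exact ⟨r, (congrArg Subtype.val hr).symm⟩

variable {G : Type*} [AddCommGroup G] {𝒜 : G → Submodule ℝ (Matrix (Fin n) (Fin n) ℂ)}
  [DecidableEq G] [GradedAlgebra 𝒜]

/-- One nonzero vector from each component gives an independent family in a finite-dimensional
space. -/
theorem finite_of_finrank (h1 : ∀ g, Module.finrank ℝ (𝒜 g) = 1) : Finite G := by
  choose X hX hX0 using exists_mem_ne_zero h1
  have hli : LinearIndependent ℝ X :=
    (DirectSum.Decomposition.isInternal 𝒜).submodule_iSupIndep.linearIndependent 𝒜 hX hX0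
  exact hli.finite

/-- Commutativity of `G` puts both products on one line, and comparing determinants makes their real
ratio an `n`-th root of unity, hence a sign. -/
theorem commute_or_anticommute (hdiv : IsDivisionGrading 𝒜)
    (h1 : ∀ g, Module.finrank ℝ (𝒜 g) = 1) {g h : G} {x y : Matrix (Fin n) (Fin n) ℂ}
    (hx : x ∈ 𝒜 g) (hy : y ∈ 𝒜 h) (hx0 : x ≠ 0) (hy0 : y ≠ 0) :
    x * y = y * x ∨ x * y = -(y * x) := by
  have := nontrivial_of_finrank h1
  have hn : n ≠ 0 := by
    rintro rfl
    exact not_subsingleton (Matrix (Fin 0) (Fin 0) ℂ) inferInstance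
  have ux := hdiv g x hx hx0
  have uy := hdiv h y hy hy0
  obtain ⟨r, hr⟩ := exists_eq_smul h1 (SetLike.GradedMul.mul_mem hx hy)
    (add_comm h g ▸ SetLike.GradedMul.mul_mem hy hx) (uy.mul ux).ne_zero
  have hdet : (r : ℂ) ^ n = 1 := by
    have h2 := congrArg Matrix.det hr
    rw [← Complex.coe_smul, Matrix.det_smul, Matrix.det_mul, Matrix.det_mul, Fintype.card_fin,
      mul_comm y.det] at h2
    have h3 : x.det * y.det ≠ 0 := by
      rw [← Matrix.det_mul]
      exact ((Matrix.isUnit_iff_isUnit_det _).1 (ux.mul uy)).ne_zero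
    exact (mul_eq_right₀ h3).1 h2.symm
  have hr1 : |r| = 1 := by
    have h2 : r ^ n = 1 := by exact_mod_cast hdet
    have h3 := congrArg abs h2
    rw [abs_pow, abs_one] at h3
    exact (pow_eq_one_iff_of_nonneg (abs_nonneg r) hn).1 h3
  rcases (abs_eq zero_le_one).1 hr1 with rfl | rfl
  · exact Or.inl (by rw [hr, one_smul])
  · exact Or.inr (by rw [hr, neg_smul, one_smul])

/-- The commutation form of a division grading with one-dimensional components. -/
theorem exists_form (hdiv : IsDivisionGrading 𝒜) (h1 : ∀ g, Module.finrank ℝ (𝒜 g) = 1) :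
    ∃ β : G →+ G →+ ZMod 2, (∀ g, β g g = 0) ∧
      (∀ g h, ∀ x ∈ 𝒜 g, ∀ y ∈ 𝒜 h, β g h = 0 → Commute x y) ∧
      (∀ g h, ∀ x ∈ 𝒜 g, ∀ y ∈ 𝒜 h, β g h = 1 → x * y = -(y * x)) ∧
      ∀ g h, ∀ x ∈ 𝒜 g, ∀ y ∈ 𝒜 h, x ≠ 0 → y ≠ 0 → Commute x y → β g h = 0 := by
  classical
  have := nontrivial_of_finrank h1
  choose X hX hX0 using exists_mem_ne_zero h1
  have hu : ∀ g, IsUnit (X g) := fun g => hdiv g _ (hX g) (hX0 g)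
  let σ : ZMod 2 → ℝ := fun c => if c = 0 then 1 else -1
  have h01 : ∀ c : ZMod 2, c = 0 ∨ c = 1 := by decide
  have hσ0 : σ 0 = 1 := if_pos rfl
  have hσ1 : σ 1 = -1 := if_neg one_ne_zero
  have hσadd : ∀ u v, σ (u + v) = σ u * σ v := by
    have h2 : (1 + 1 : ZMod 2) = 0 := by decide
    intro u v
    rcases h01 u with rfl | rfl <;> rcases h01 v with rfl | rfl <;>
      simp only [add_zero, zero_add, h2, hσ0, hσ1] <;> norm_num
  have hσinj : ∀ u v, σ u = σ v → u = v := by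
    intro u v h
    rcases h01 u with rfl | rfl <;> rcases h01 v with rfl | rfl <;>
      simp only [hσ0, hσ1] at h <;> first | rfl | (norm_num at h)
  let s : G → G → ZMod 2 := fun g h => if X g * X h = X h * X g then 0 else 1
  have hs : ∀ g h, X g * X h = σ (s g h) • (X h * X g) := by
    intro g h
    by_cases hc : X g * X h = X h * X g
    · rw [show s g h = 0 from if_pos hc, hσ0, one_smul, hc]
    · rw [show s g h = 1 from if_neg hc, hσ1, neg_smul, one_smul]
      exact (commute_or_anticommute hdiv h1 (hX g) (hX h) (hX0 g) (hX0 h)).resolve_left hc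
  -- The sign is determined by the relation since `X h * X g` is nonzero; biadditivity thus reduces
  -- to moving `X h` past `X g * X g'`.
  have huniq : ∀ g h u, X g * X h = σ u • (X h * X g) → s g h = u := by
    intro g h u hgh
    rw [hs g h] at hgh
    exact hσinj _ _ (smul_left_injective ℝ ((hu h).mul (hu g)).ne_zero hgh)
  have hcomm : ∀ g h, s g h = s h g := fun g h => by
    simp only [s, eq_comm]
  have hadd : ∀ g g' h, s (g + g') h = s g h + s g' h := by
    intro g g' h
    apply huniq
    obtain ⟨r, hr⟩ := exists_eq_smul h1 (hX (g + g')) (SetLike.GradedMul.mul_mem (hX g) (hX g'))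
      ((hu g).mul (hu g')).ne_zero
    rw [hr, smul_mul_assoc, mul_assoc, hs g' h, mul_smul_comm, ← mul_assoc, hs g h, hσadd,
      smul_mul_assoc, mul_smul_comm, smul_smul, smul_smul, smul_smul, mul_assoc]
    congr 1
    · ring
    · rw [mul_assoc]
  let β : G →+ G →+ ZMod 2 := AddMonoidHom.mk' (fun g => AddMonoidHom.mk' (s g) fun h h' => by
    rw [hcomm, hadd, hcomm h, hcomm h']) fun g g' => by
      ext h
      exact hadd g g' h
  have hβ : ∀ g h, β g h = s g h := fun _ _ => rfl
  have hgen : ∀ g h, ∀ x ∈ 𝒜 g, ∀ y ∈ 𝒜 h, x * y = σ (β g h) • (y * x) := by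
    intro g h x hx y hy
    obtain ⟨r, rfl⟩ := exists_eq_smul h1 hx (hX g) (hX0 g)
    obtain ⟨t, rfl⟩ := exists_eq_smul h1 hy (hX h) (hX0 h)
    rw [smul_mul_smul_comm, smul_mul_smul_comm, hs, hβ, smul_comm, mul_comm r t]
  refine ⟨β, fun g => ?_, fun g h x hx y hy h0 => ?_, fun g h x hx y hy h0 => ?_,
    fun g h x hx y hy hx0 hy0 hc => ?_⟩
  · exact if_pos rfl
  · rw [commute_iff_eq, hgen g h x hx y hy, h0, hσ0, one_smul]
  · rw [hgen g h x hx y hy, h0, hσ1, neg_smul, one_smul]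
  · have hne := ((hdiv h y hy hy0).mul (hdiv g x hx hx0)).ne_zero
    have h2 := hgen g h x hx y hy
    refine hσinj _ _ (smul_left_injective ℝ hne ?_)
    dsimp only
    rw [← h2, hσ0, one_smul, hc.eq]

/-- What commutes with all homogeneous elements is a scalar. -/
theorem exists_smul_one_of_commute {x : Matrix (Fin n) (Fin n) ℂ}
    (hx : ∀ g, ∀ y ∈ 𝒜 g, Commute x y) : ∃ z : ℂ, x = z • 1 := by
  have hall : ∀ y, Commute x y := by
    intro y
    induction y using DirectSum.Decomposition.inductionOn 𝒜 with
    | zero => exact Commute.zero_right x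
    | homogeneous y => exact hx _ y y.2
    | add y y' h h' => exact h.add_right h'
  obtain ⟨z, hz⟩ := Matrix.mem_range_scalar_of_commute_single fun i j _ => (hall (Matrix.single i j 1)).symm
  exact ⟨z, by rw [← hz, Matrix.smul_one_eq_diagonal]; rfl⟩

/-- The homogeneous components of the central element `i` are again central, hence complex scalars.
One of them has nonzero degree, as degree `0` contains only real scalars; with `1` it spans `ℂ` over
`ℝ`, leaving no room for a third central degree. -/
theorem exists_degree_I (h1 : ∀ g, Module.finrank ℝ (𝒜 g) = 1) :
    ∃ f : G, f ≠ 0 ∧ 2 • f = 0 ∧ Complex.I • 1 ∈ 𝒜 f ∧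
      ∀ g, ∀ x ∈ 𝒜 g, x ≠ 0 → (∀ h, ∀ y ∈ 𝒜 h, Commute x y) → g = 0 ∨ g = f := by
  have := nontrivial_of_finrank h1
  have hone : (1 : Matrix (Fin n) (Fin n) ℂ) ∈ 𝒜 0 := SetLike.GradedOne.one_mem
  have hreal : ∀ r : ℝ, (r : ℂ) • (1 : Matrix (Fin n) (Fin n) ℂ) ∈ 𝒜 0 := fun r => by
    rw [Complex.coe_smul]
    exact Submodule.smul_mem _ _ hone
  have him : ∀ {g : G} {z : ℂ}, g ≠ 0 → z • (1 : Matrix (Fin n) (Fin n) ℂ) ∈ 𝒜 g → z ≠ 0 →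
      z.im ≠ 0 := by
    intro g z hg hz hz0 h0
    have h2 : z = (z.re : ℂ) := Complex.ext rfl (by simpa using h0)
    refine hg (DirectSum.degree_eq_of_mem_mem 𝒜 hz (h2 ▸ hreal z.re) ?_)
    exact smul_ne_zero hz0 one_ne_zero
  let p : G → Matrix (Fin n) (Fin n) ℂ := fun g => DirectSum.decompose 𝒜 (Complex.I • 1) g
  have hp : ∀ g, ∃ z : ℂ, p g = z • 1 := fun g => by
    refine exists_smul_one_of_commute (𝒜 := 𝒜) fun h y hy => ?_
    have h2 := DirectSum.coe_decompose_mul_add_of_right_mem 𝒜 (a := Complex.I • 1) (i := g) hy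
    have h3 := DirectSum.coe_decompose_mul_add_of_left_mem 𝒜 (b := Complex.I • 1) (j := g) hy
    rw [mul_smul_comm, mul_one, add_comm h g] at h3
    rw [smul_mul_assoc, one_mul] at h2
    exact h2.symm.trans h3
  obtain ⟨f, hf0, hpf⟩ : ∃ f, f ≠ 0 ∧ p f ≠ 0 := by
    by_contra! hcon
    have hI : Complex.I • (1 : Matrix (Fin n) (Fin n) ℂ) = p 0 := by
      have := DirectSum.sum_support_decompose 𝒜 (Complex.I • (1 : Matrix (Fin n) (Fin n) ℂ))
      conv_lhs => rw [← this]
      refine Finset.sum_eq_single 0 (fun g _ hg => hcon g hg) fun h => ?_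
      rw [DFinsupp.notMem_support_iff.1 h]
      rfl
    have hI0 : Complex.I • (1 : Matrix (Fin n) (Fin n) ℂ) ∈ 𝒜 0 := by
      rw [hI]
      exact (DirectSum.decompose 𝒜 (Complex.I • 1) 0).2
    obtain ⟨r, hr⟩ := exists_eq_smul h1 hI0 hone one_ne_zero
    rw [← Complex.coe_smul] at hr
    have := smul_left_injective ℂ (one_ne_zero (α := Matrix (Fin n) (Fin n) ℂ)) hr
    simpa using congrArg Complex.im this
  obtain ⟨z, hz⟩ := hp f
  have hzf : z • 1 ∈ 𝒜 f := hz ▸ (DirectSum.decompose 𝒜 (Complex.I • 1) f).2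
  have hz0 : z ≠ 0 := by
    rintro rfl
    rw [zero_smul] at hz
    exact hpf hz
  have hzim := him hf0 hzf hz0
  have hrad : ∀ g, ∀ x ∈ 𝒜 g, x ≠ 0 → (∀ h, ∀ y ∈ 𝒜 h, Commute x y) → g = 0 ∨ g = f := by
    intro g x hx hx0 hc
    obtain ⟨w, rfl⟩ := exists_smul_one_of_commute hc
    have hw0 : w ≠ 0 := by
      rintro rfl
      exact hx0 (zero_smul _ _)
    by_contra! hg
    -- `w` is a real combination of `1` and `z`
    obtain ⟨a, b, hab⟩ : ∃ a b : ℝ, w = a + b * z := by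
      refine ⟨w.re - w.im / z.im * z.re, w.im / z.im, Complex.ext ?_ ?_⟩
      · simp
      · simp [hzim]
    have h2 : DirectSum.decompose 𝒜 (w • (1 : Matrix (Fin n) (Fin n) ℂ)) g = 0 := by
      apply Subtype.ext
      rw [hab, add_smul, mul_smul, Complex.coe_smul b, DirectSum.decompose_add,
        DirectSum.add_apply, Submodule.coe_add,
        DirectSum.decompose_of_mem_ne 𝒜 (hreal a) hg.1.symm,
        DirectSum.decompose_of_mem_ne 𝒜 (Submodule.smul_mem _ b hzf) hg.2.symm]
      simp
    have h3 := DirectSum.decompose_of_mem_same 𝒜 hx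
    rw [h2] at h3
    exact hx0 h3.symm
  have hzz : (z * z) • (1 : Matrix (Fin n) (Fin n) ℂ) ∈ 𝒜 (f + f) := by
    have := SetLike.GradedMul.mul_mem hzf hzf
    rwa [smul_mul_smul_comm, one_mul] at this
  -- The square of the scalar `z` is central, so its degree is `0` or `f`, and `f + f = f` would
  -- force `f = 0`.
  have hff : f + f = 0 := by
    rcases hrad (f + f) _ hzz (smul_ne_zero (mul_ne_zero hz0 hz0) one_ne_zero)
      fun h y _ => (Commute.one_left y).smul_left _ with h | h
    · exact h
    · exact absurd (add_eq_left.1 h) hf0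
  -- Now `z * z` has degree `0`, so it is real; as `z` is not real, it is purely imaginary and `i`
  -- is a real multiple of it.
  have hre : z.re = 0 := by
    rw [hff] at hzz
    obtain ⟨r, hr⟩ := exists_eq_smul h1 hzz hone one_ne_zero
    rw [← Complex.coe_smul] at hr
    have h2 := congrArg Complex.im (smul_left_injective ℂ
      (one_ne_zero (α := Matrix (Fin n) (Fin n) ℂ)) hr)
    simp only [Complex.mul_im, Complex.ofReal_im] at h2
    have h3 : z.re * z.im = 0 := by linarith
    exact (mul_eq_zero.1 h3).resolve_right hzim
  refine ⟨f, hf0, by rw [two_nsmul, hff], ?_, hrad⟩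
  have hI : Complex.I • (1 : Matrix (Fin n) (Fin n) ℂ) = z.im⁻¹ • z • 1 := by
    rw [← Complex.coe_smul, smul_smul]
    congr 1
    refine Complex.ext ?_ ?_ <;> simp [hre, hzim]
  rw [hI]
  exact Submodule.smul_mem _ _ hzf

theorem exists_isCommutationForm (hdiv : IsDivisionGrading 𝒜)
    (h1 : ∀ g, Module.finrank ℝ (𝒜 g) = 1) :
    ∃ (β : G →+ G →+ ZMod 2) (f : G), IsCommutationForm 𝒜 β f := by
  have := nontrivial_of_finrank h1
  obtain ⟨β, halt, hcomm, hanti, hzero⟩ := exists_form hdiv h1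
  obtain ⟨f, hf0, hf2, hI, hrad⟩ := exists_degree_I h1
  refine ⟨β, f, halt, fun hx hy => hcomm _ _ _ hx _ hy, fun hx hy => hanti _ _ _ hx _ hy,
    fun g hg => ?_, hf0, fun h => ?_, hf2, hI, fun {g u} hu hu0 => ?_⟩
  · obtain ⟨x, hx, hx0⟩ := exists_mem_ne_zero h1 g
    exact hrad g x hx hx0 fun h y hy => hcomm g h x hx y hy (hg h)
  · obtain ⟨y, hy, hy0⟩ := exists_mem_ne_zero h1 h
    exact hzero f h _ hI y hy (smul_ne_zero Complex.I_ne_zero one_ne_zero) hy0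
      ((Commute.one_left y).smul_left _)
  · obtain ⟨x, hx, hx0⟩ := exists_mem_ne_zero h1 g
    obtain ⟨r, hr⟩ := exists_eq_smul h1 (SetLike.GradedMul.mul_mem hx hx) hu hu0
    refine ⟨x, hx, r, ?_, hr⟩
    rintro rfl
    have hux := hdiv g x hx hx0
    exact (hux.mul hux).ne_zero (hr.trans (zero_smul _ _))

end ComplexMatrixGradings

/-! ### Splitting off the tensor factors. -/

section Classification

variable {n : ℕ} {G : Type*} [AddCommGroup G] {𝒜 : G → Submodule ℝ (Matrix (Fin n) (Fin n) ℂ)}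
  {β : G →+ G →+ ZMod 2} {f : G}

/-- Up to a shift by `f`, a homogeneous element can be chosen with prescribed square. -/
theorem IsCommutationForm.exists_mul_self_eq [SetLike.GradedMonoid 𝒜]
    (hβ : IsCommutationForm 𝒜 β f) {g : G} {u : Matrix (Fin n) (Fin n) ℂ}
    (hu : u ∈ 𝒜 (g + g)) (hu0 : u ≠ 0) :
    ∃ g', (g' = g ∨ g' = g + f) ∧ ∃ x ∈ 𝒜 g', x * x = u := by
  obtain ⟨x, hx, r, hr0, hr⟩ := hβ.square hu hu0
  rcases lt_or_gt_of_ne hr0 with h | h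
  · refine ⟨g + f, Or.inr rfl, (Real.sqrt (-r))⁻¹ • (x * (Complex.I • 1)),
      Submodule.smul_mem _ _ (SetLike.GradedMul.mul_mem hx hβ.I_mem), ?_⟩
    have hxI : x * (Complex.I • 1) = Complex.I • x := by rw [mul_smul_comm, mul_one]
    rw [hxI, smul_mul_smul_comm, smul_mul_smul_comm, Complex.I_mul_I, hr,
      ← mul_inv, Real.mul_self_sqrt (by linarith), neg_smul, one_smul, smul_neg, ← neg_smul,
      smul_smul, inv_neg, neg_neg, inv_mul_cancel₀ hr0, one_smul]
  · refine ⟨g, Or.inl rfl, (Real.sqrt r)⁻¹ • x, Submodule.smul_mem _ _ hx, ?_⟩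
    rw [smul_mul_smul_comm, hr, ← mul_inv, Real.mul_self_sqrt h.le, smul_smul,
      inv_mul_cancel₀ hr0, one_smul]

theorem IsCommutationForm.form_shift_left (hβ : IsCommutationForm 𝒜 β f) {g g' : G}
    (h : g' = g ∨ g' = g + f) (v : G) : β g' v = β g v := by
  rcases h with rfl | rfl
  · rfl
  · rw [map_add, AddMonoidHom.add_apply, hβ.form_eq_zero, add_zero]

theorem IsCommutationForm.form_shift_right (hβ : IsCommutationForm 𝒜 β f) {g g' : G}
    (h : g' = g ∨ g' = g + f) (v : G) : β v g' = β v g := by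
  rw [form_comm hβ.alt, hβ.form_shift_left h, form_comm hβ.alt]

theorem IsCommutationForm.two_nsmul_shift (hβ : IsCommutationForm 𝒜 β f) {g g' : G}
    (h : g' = g ∨ g' = g + f) : 2 • g' = 2 • g := by
  rcases h with rfl | rfl
  · rfl
  · rw [smul_add, hβ.order_two, add_zero]

theorem IsCommutationForm.two_nsmul_eq (hβ : IsCommutationForm 𝒜 β f) (g : G) :
    2 • g = 0 ∨ 2 • g = f :=
  hβ.radical _ fun v => form_two_nsmul_left g v

/-- A homomorphism from a tensor power of `M₂(ℝ)` given by a symplectic family of elements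
with square one. -/
theorem IsCommutationForm.exists_algHom_powerBasis [SetLike.GradedMonoid 𝒜]
    (hβ : IsCommutationForm 𝒜 β f) {k : ℕ} {a b : Fin k → G} (hs : IsSymplectic β a b)
    {x y : Fin k → Matrix (Fin n) (Fin n) ℂ} (hx : ∀ i, x i ∈ 𝒜 (a i)) (hy : ∀ i, y i ∈ 𝒜 (b i))
    (hxx : ∀ i, x i * x i = 1) (hyy : ∀ i, y i * y i = 1) :
    ∃ Ψ : (⨂[ℝ] _ : Fin k, Matrix (Fin 2) (Fin 2) ℝ) →ₐ[ℝ] Matrix (Fin n) (Fin n) ℂ,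
      (∀ g, Ψ (powerBasis k g) ∈ 𝒜 (pairSum a b g)) ∧
        ∀ z, (∀ i, Commute z (x i) ∧ Commute z (y i)) → ∀ t, Commute z (Ψ t) := by
  have hxy : ∀ i, x i * y i = -(y i * x i) := fun i =>
    hβ.anticommute (hx i) (hy i) (by rw [hs.cross, if_pos rfl])
  choose ψ hψA hψB hψ using fun i =>
    exists_algHom_matrix_two (K := ℝ) (hxx i) (hyy i) (hxy i)
  have hc : ∀ i j, i ≠ j → ∀ m m', Commute (ψ i m) (ψ j m') := by
    intro i j hij m m'
    have hxx := hβ.commute (hx j) (hx i) (hs.left j i)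
    have hyy := hβ.commute (hy j) (hy i) (hs.right j i)
    have hxy := hβ.commute (hx j) (hy i) (by rw [hs.cross, if_neg hij.symm])
    have hyx := (hβ.commute (hx i) (hy j) (by rw [hs.cross, if_neg hij])).symm
    exact hψ j _ (hψ i _ hxx hxy m).symm (hψ i _ hyx hyy m).symm m'
  obtain ⟨Ψ, hΨ⟩ := exists_piTensorProduct_algHom ψ hc
  have hpw : ∀ m : Fin k → Matrix (Fin 2) (Fin 2) ℝ, ((Finset.univ : Finset (Fin k)) : Set (Fin k)).Pairwise
      (Function.onFun Commute fun i => ψ i (m i)) := fun _ _ _ _ _ h => hc _ _ h _ _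
  refine ⟨Ψ, fun g => ?_, fun z hz t => ?_⟩
  · rw [powerBasis, hΨ _ (hpw _), pairSum]
    refine noncommProd_mem_graded 𝒜 _ _ _ _ fun i _ => ?_
    rw [map_mul, map_pow, map_pow, hψA, hψB]
    exact SetLike.GradedMul.mul_mem (SetLike.pow_mem_graded _ (hx i))
      (SetLike.pow_mem_graded _ (hy i))
  · induction t using PiTensorProduct.induction_on with
    | smul_tprod r m =>
      rw [map_smul, hΨ _ (hpw _)]
      exact (Finset.noncommProd_commute _ _ _ _ fun i _ => hψ i z (hz i).1 (hz i).2 _).smul_right _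
    | add t t' h h' => rw [map_add]; exact h.add_right h'

/-- The part of the algebra supported in a subgroup consisting of elements of order two. -/
theorem IsCommutationForm.exists_power [Finite G] [SetLike.GradedMonoid 𝒜]
    (hβ : IsCommutationForm 𝒜 β f) (K : AddSubgroup G) (hfK : f ∈ K)
    (hK : ∀ g ∈ K, 2 • g = 0) :
    ∃ (k : ℕ) (a b : Fin k → G), IsSymplectic β a b ∧ (∀ i, a i ∈ K ∧ b i ∈ K) ∧
      (∀ w ∈ K, (∀ i, β w (a i) = 0 ∧ β w (b i) = 0) → ∀ v ∈ K, β w v = 0) ∧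
      ∃ Ψ : (⨂[ℝ] _ : Fin k, Matrix (Fin 2) (Fin 2) ℝ) →ₐ[ℝ] Matrix (Fin n) (Fin n) ℂ,
        (∀ g, Ψ (powerBasis k g) ∈ 𝒜 (pairSum a b g)) ∧
          ∀ d, ∀ z ∈ 𝒜 d, (∀ v ∈ K, β d v = 0) → ∀ t, Commute z (Ψ t) := by
  obtain ⟨k, a, b, hs, habK, hmax⟩ := exists_maximal_isSymplectic hβ.alt K
  rcases subsingleton_or_nontrivial (Matrix (Fin n) (Fin n) ℂ) with hsub | hnt
  · obtain ⟨x, hx⟩ : ∃ x : Fin k → Matrix (Fin n) (Fin n) ℂ, x = 0 := ⟨_, rfl⟩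
    have hmem : ∀ g (x : Matrix (Fin n) (Fin n) ℂ), x ∈ 𝒜 g := fun g x => by
      rw [Subsingleton.elim x 0]; exact zero_mem _
    obtain ⟨Ψ, h, -⟩ := hβ.exists_algHom_powerBasis hs (x := x) (y := x) (fun _ => hmem _ _)
      (fun _ => hmem _ _) (fun _ => Subsingleton.elim _ _) (fun _ => Subsingleton.elim _ _)
    exact ⟨k, a, b, hs, habK, hmax, Ψ, h, fun _ _ _ _ _ => Subsingleton.elim _ _⟩
  -- Degrees in `K` double to `0`, so square one can be prescribed. The resulting shifts by `f` stay
  -- in `K` and do not change `β`.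
  have hone : ∀ g ∈ K, (1 : Matrix (Fin n) (Fin n) ℂ) ∈ 𝒜 (g + g) := fun g hg => by
    rw [← two_nsmul g, hK g hg]
    exact SetLike.GradedOne.one_mem
  choose a' ha' x hx hxx using fun i => hβ.exists_mul_self_eq (hone _ (habK i).1) one_ne_zero
  choose b' hb' y hy hyy using fun i => hβ.exists_mul_self_eq (hone _ (habK i).2) one_ne_zero
  have hsh : ∀ {g g'}, (g' = g ∨ g' = g + f) → g ∈ K → g' ∈ K := by
    rintro g _ (rfl | rfl) hg
    exacts [hg, K.add_mem hg hfK]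
  have habK' : ∀ i, a' i ∈ K ∧ b' i ∈ K := fun i => ⟨hsh (ha' i) (habK i).1, hsh (hb' i) (habK i).2⟩
  have hs' : IsSymplectic β a' b' :=
    ⟨fun i j => by rw [hβ.form_shift_left (ha' i), hβ.form_shift_right (ha' j), hs.left],
      fun i j => by rw [hβ.form_shift_left (hb' i), hβ.form_shift_right (hb' j), hs.right],
      fun i j => by rw [hβ.form_shift_left (ha' i), hβ.form_shift_right (hb' j), hs.cross]⟩
  obtain ⟨Ψ, hΨ, hcomm⟩ := hβ.exists_algHom_powerBasis hs' hx hy hxx hyy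
  refine ⟨k, a', b', hs', habK', fun w hw h => hmax w hw fun i => ?_, Ψ, hΨ,
    fun d z hz hd => hcomm z fun i => ?_⟩
  · rw [← hβ.form_shift_right (ha' i), ← hβ.form_shift_right (hb' i)]
    exact h i
  · exact ⟨hβ.commute hz (hx i) (hd _ (habK' i).1), hβ.commute hz (hy i) (hd _ (habK' i).2)⟩

variable [DecidableEq G] [GradedAlgebra 𝒜]

theorem IsCommutationForm.weaklyIsomorphic_typeOne [Finite G] (hβ : IsCommutationForm 𝒜 β f)
    (h1 : ∀ g, Module.finrank ℝ (𝒜 g) = 1) (h2 : ∀ g : G, 2 • g = 0) :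
    ∃ k, WeaklyIsomorphic (S := AlgOne k) 𝒜 (typeOne k) := by
  have := nontrivial_of_finrank h1
  obtain ⟨k, a, b, hs, -, hmax, Ψ, hΨ, -⟩ := hβ.exists_power ⊤ trivial fun g _ => h2 g
  obtain ⟨α, hα⟩ := hs.exists_addEquiv hβ.alt hβ.ne_zero hβ.form_eq_zero h2 fun w hw =>
    hβ.radical w fun v => hmax w trivial hw v trivial
  let ι : ℂ →ₐ[ℝ] Matrix (Fin n) (Fin n) ℂ :=
    (Algebra.ofId ℂ (Matrix (Fin n) (Fin n) ℂ)).restrictScalars ℝ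
  have hι : ∀ z, ι z = z • 1 := fun z => Algebra.algebraMap_eq_smul_one z
  let Φ : AlgOne k →ₐ[ℝ] Matrix (Fin n) (Fin n) ℂ :=
    Algebra.TensorProduct.lift Ψ ι fun t z => by
      rw [hι]
      exact (Commute.one_right _).smul_right _
  obtain ⟨B, hB⟩ := exists_basis_basisOne k
  refine ⟨k, ?_⟩
  rw [typeOne_eq_span]
  refine (isTwisted_basisOne k).weaklyIsomorphic (S := AlgOne k) B hB 𝒜 h1 Φ α fun h => ?_
  rw [hα, basisOne, Algebra.TensorProduct.lift_tmul]
  refine SetLike.GradedMul.mul_mem (hΨ h.1) ?_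
  rw [map_pow]
  refine SetLike.pow_mem_graded _ ?_
  rw [hι]
  exact hβ.I_mem

/-- A degree `e` of order four is paired with the `c` that detects such degrees. Being orthogonal to
`c` then means being killed by two, so the complement of the pair splits into copies of `M₂(ℝ)`. -/
theorem IsCommutationForm.weaklyIsomorphic_typeTwo [Finite G] (hβ : IsCommutationForm 𝒜 β f)
    (h1 : ∀ g, Module.finrank ℝ (𝒜 g) = 1) (h2 : ∃ g : G, 2 • g ≠ 0) :
    ∃ m, WeaklyIsomorphic (S := AlgTwo m) 𝒜 (typeTwo m) := by
  classical
  have := nontrivial_of_finrank h1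
  have h01 : ∀ c : ZMod 2, c = 0 ∨ c = 1 := by decide
  -- the character `g ↦ [2 g = f]` is represented by some `c`
  let q : G →+ ZMod 2 := AddMonoidHom.mk' (fun g => if 2 • g = 0 then 0 else 1) fun g h => by
    have hff : f + f = 0 := by rw [← two_nsmul f, hβ.order_two]
    have h11 : (1 + 1 : ZMod 2) = 0 := by decide
    rw [smul_add]
    rcases hβ.two_nsmul_eq g with hg | hg <;> rcases hβ.two_nsmul_eq h with hh | hh <;>
      simp [hg, hh, hff, hβ.ne_zero, h11]
  have hq : ∀ g, q g = 0 ↔ 2 • g = 0 := fun g => by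
    change (if 2 • g = 0 then (0 : ZMod 2) else 1) = 0 ↔ _
    simp
  obtain ⟨c, hc⟩ := exists_form_eq hβ.alt hβ.radical q ((hq f).2 hβ.order_two)
  obtain ⟨e, he⟩ := h2
  have hec : β e c = 1 := by
    rw [hc]
    exact (h01 _).resolve_left fun h => he ((hq e).1 h)
  have hef : 2 • e = f := (hβ.two_nsmul_eq e).resolve_left he
  -- The detecting element does not detect itself, because `β` is alternating.
  have hc2 : 2 • c = 0 := (hq c).1 ((hc c).symm.trans (hβ.alt c))
  have hI : Complex.I • 1 ∈ 𝒜 (e + e) := by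
    rw [← two_nsmul e, hef]
    exact hβ.I_mem
  obtain ⟨e', he', x, hx, hxx⟩ := hβ.exists_mul_self_eq hI
    (smul_ne_zero Complex.I_ne_zero one_ne_zero)
  -- The prescribed squares `i` and `-1` are those of `ω A` and `C` in the model.
  have hneg : (-1 : Matrix (Fin n) (Fin n) ℂ) ∈ 𝒜 (c + c) := by
    rw [← two_nsmul c, hc2]
    exact neg_mem SetLike.GradedOne.one_mem
  obtain ⟨c', hc', y, hy, hyy⟩ := hβ.exists_mul_self_eq hneg (neg_ne_zero.2 one_ne_zero)
  rw [← hβ.form_shift_left he', ← hβ.form_shift_right hc'] at hec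
  rw [← hβ.two_nsmul_shift he'] at hef
  have hcg : ∀ g, β g c' = 0 → 2 • g = 0 := fun g hg => by
    rw [hβ.form_shift_right hc', hc] at hg
    exact (hq g).1 hg
  have hc2' : 2 • c' = 0 := hcg c' (hβ.alt c')
  have hxy := hβ.anticommute hx hy hec
  -- the orthogonal complement of `e', c'`
  let K : AddSubgroup G := (β e').ker ⊓ (β c').ker
  have hmem : ∀ {g}, g ∈ K ↔ β e' g = 0 ∧ β c' g = 0 := Iff.rfl
  have hfK : f ∈ K := hmem.2
    ⟨by rw [form_comm hβ.alt, hβ.form_eq_zero], by rw [form_comm hβ.alt, hβ.form_eq_zero]⟩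
  obtain ⟨m, a, b, hs, habK, hmax, Ψ, hΨ, hΨc⟩ := hβ.exists_power K hfK fun g hg =>
    hcg g (by rw [form_comm hβ.alt]; exact hg.2)
  -- Since `β e' c' = 1`, the group is generated by `K`, `e'` and `c'`; an element of `K` orthogonal
  -- to `K` is therefore orthogonal to everything.
  have hKrad : ∀ w ∈ K, (∀ v ∈ K, β w v = 0) → w = 0 ∨ w = f := by
    intro w hw hwK
    refine hβ.radical w fun v => ?_
    have hv : v - ((β v c').val • e' + (β v e').val • c') ∈ K := by
      refine hmem.2 ⟨?_, ?_⟩ <;> rw [form_comm hβ.alt] <;>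
        simp [hβ.alt, hec, form_comm hβ.alt c' e']
    have h3 := hwK _ hv
    have h4 : β w e' = 0 := by rw [form_comm hβ.alt]; exact hw.1
    have h5 : β w c' = 0 := by rw [form_comm hβ.alt]; exact hw.2
    simpa [h4, h5] using h3
  obtain ⟨α, hα⟩ := hs.exists_addEquiv_four hβ.alt hβ.ne_zero hβ.order_two hef hc2' hec
    (fun i => ⟨hcg _ (by rw [form_comm hβ.alt]; exact (habK i).1.2),
      hcg _ (by rw [form_comm hβ.alt]; exact (habK i).2.2)⟩)
    (fun i => (habK i).1) (fun i => (habK i).2) fun w hwe hwc hw => by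
      have hwK : w ∈ K := hmem.2 ⟨by rw [form_comm hβ.alt, hwe], by rw [form_comm hβ.alt, hwc]⟩
      exact hKrad w hwK (hmax w hwK hw)
  -- `M₂(ℂ)` is generated over `ℂ` by `ω⁻¹ x` and `ω⁻¹ x y`
  set x' := omega⁻¹ • x with hx'
  have hxx' : x' * x' = 1 := by
    rw [hx', smul_mul_smul_comm, hxx, ← mul_inv, omega_mul_omega, smul_smul,
      inv_mul_cancel₀ Complex.I_ne_zero, one_smul]
  have hxy' : x' * y = -(y * x') := by
    rw [hx', smul_mul_assoc, hxy, mul_smul_comm, smul_neg]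
  have hxx'' : ∀ z, x' * (x' * z) = z := fun z => by rw [← mul_assoc, hxx', one_mul]
  obtain ⟨ψ, hψA, hψB, hψ⟩ := exists_algHom_matrix_two (K := ℂ) (x := x') (y := x' * y) hxx'
    (by
      calc x' * y * (x' * y) = x' * (y * x') * y := by simp only [mul_assoc]
        _ = -(x' * (x' * (y * y))) := by rw [← neg_eq_iff_eq_neg.2 hxy']; simp only [mul_neg, neg_mul, mul_assoc]
        _ = 1 := by rw [hxx'', hyy, neg_neg])
    (by rw [hxx'', mul_assoc, ← neg_eq_iff_eq_neg.2 hxy', mul_neg, hxx'', neg_neg])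
  have hcx : ∀ t, Commute (Ψ t) x' := fun t => by
    refine ((hΨc e' x hx (fun v hv => hv.1) t).smul_left _).symm
  have hcy : ∀ t, Commute (Ψ t) y := fun t => (hΨc c' y hy (fun v hv => hv.2) t).symm
  let Φ : AlgTwo m →ₐ[ℝ] Matrix (Fin n) (Fin n) ℂ :=
    Algebra.TensorProduct.lift (ψ.restrictScalars ℝ) Ψ fun z t =>
      (hψ (Ψ t) (hcx t) ((hcx t).mul_right (hcy t)) z).symm
  have hΦ : ∀ z t, Φ (z ⊗ₜ[ℝ] t) = ψ z * Ψ t := fun z t =>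
    Algebra.TensorProduct.lift_tmul _ _ _ z t
  have hωA : ψ (omega • matA ℂ) = x := by
    rw [map_smul, hψA, hx', smul_smul, mul_inv_cancel₀ omega_ne_zero, one_smul]
  have hC : ψ (matC ℂ) = y := by
    rw [← matA_mul_matB_eq, map_mul, hψA, hψB, hxx'']
  obtain ⟨B, hB⟩ := exists_basis_basisTwo m
  refine ⟨m, ?_⟩
  rw [typeTwo_eq_span]
  refine (isTwisted_basisTwo m).weaklyIsomorphic (S := AlgTwo m) B hB 𝒜 h1 Φ α fun h => ?_
  rw [hα, basisTwo, hΦ]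
  refine SetLike.GradedMul.mul_mem ?_ (hΨ h.2)
  rw [map_mul, map_pow, map_pow, hωA, hC]
  exact SetLike.GradedMul.mul_mem (SetLike.pow_mem_graded _ hx) (SetLike.pow_mem_graded _ hy)

end Classification

/-! ### Matrix size and the structure of the grading group. -/

section Orders

theorem eq_of_matrix_algEquiv {n N : ℕ}
    (e : Matrix (Fin n) (Fin n) ℂ ≃ₐ[ℝ] Matrix (Fin N) (Fin N) ℂ) : n = N := by
  have h := e.toLinearEquiv.finrank_eq
  simp only [Module.finrank_matrix, Fintype.card_fin, Complex.finrank_real_complex] at h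
  exact Nat.mul_self_inj.1 (Nat.eq_of_mul_eq_mul_right two_pos h)

theorem nonempty_addEquiv_elementary (k : ℕ) :
    Nonempty ((Fin k → ZMod 2 × ZMod 2) × ZMod 2 ≃+ (Fin (2 * k + 1) → ZMod 2)) := by
  have : Fact (Nat.Prime 2) := ⟨Nat.prime_two⟩
  refine ⟨(LinearEquiv.ofFinrankEq (R := ZMod 2) _ _ ?_).toAddEquiv⟩
  simp [Module.finrank_pi_fintype]
  ring

theorem nonempty_addEquiv_four (m : ℕ) :
    Nonempty ((ZMod 4 × ZMod 2) × (Fin m → ZMod 2 × ZMod 2) ≃+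
      ZMod 4 × (Fin (2 * m + 1) → ZMod 2)) := by
  obtain ⟨e⟩ := nonempty_addEquiv_elementary m
  exact ⟨AddEquiv.prodAssoc.trans <|
    (AddEquiv.refl (ZMod 4)).prodCongr (AddEquiv.prodComm.trans e)⟩

end Orders

end RealDivGrading

end

theorem mainTheorem5 :
    -- classification of the division gradings with one-dimensional components
    (∀ (n : ℕ) (G : Type*) [AddCommGroup G] [DecidableEq G]
        (𝒜 : G → Submodule ℝ (Matrix (Fin n) (Fin n) ℂ)) [GradedAlgebra 𝒜],
        RealDivGrading.IsDivisionGrading 𝒜 →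
        (∀ g : G, Module.finrank ℝ (𝒜 g) = 1) →
        ∃ k : ℕ, n = 2 ^ k ∧
          ((RealDivGrading.WeaklyIsomorphic (S := RealDivGrading.AlgOne k) 𝒜 (RealDivGrading.typeOne k) ∧
              Nonempty (G ≃+ (Fin (2 * k + 1) → ZMod 2))) ∨
            ∃ m : ℕ, k = m + 1 ∧
              RealDivGrading.WeaklyIsomorphic (S := RealDivGrading.AlgTwo m) 𝒜 (RealDivGrading.typeTwo m) ∧
              Nonempty (G ≃+ ZMod 4 × (Fin (2 * m + 1) → ZMod 2)))) ∧
    -- the first form occurs on `M_n(ℂ)`, `n = 2 ^ k`, for every `k`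
    (∀ k : ℕ, ∃ (𝒜 : (Fin k → ZMod 2 × ZMod 2) × ZMod 2 →
          Submodule ℝ (Matrix (Fin (2 ^ k)) (Fin (2 ^ k)) ℂ)) (_ : GradedAlgebra 𝒜),
        RealDivGrading.IsDivisionGrading 𝒜 ∧ (∀ g, Module.finrank ℝ (𝒜 g) = 1) ∧
          RealDivGrading.WeaklyIsomorphic (S := RealDivGrading.AlgOne k) 𝒜 (RealDivGrading.typeOne k)) ∧
    -- the second form occurs on `M_n(ℂ)`, `n = 2 ^ k`, for every `k = m + 1`
    (∀ m : ℕ, ∃ (𝒜 : (ZMod 4 × ZMod 2) × (Fin m → ZMod 2 × ZMod 2) →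
          Submodule ℝ (Matrix (Fin (2 ^ (m + 1))) (Fin (2 ^ (m + 1))) ℂ)) (_ : GradedAlgebra 𝒜),
        RealDivGrading.IsDivisionGrading 𝒜 ∧ (∀ g, Module.finrank ℝ (𝒜 g) = 1) ∧
          RealDivGrading.WeaklyIsomorphic (S := RealDivGrading.AlgTwo m) 𝒜 (RealDivGrading.typeTwo m)) := by
  refine ⟨fun n G _ _ 𝒜 _ hdiv h1 => ?_, fun k => ?_, fun m => ?_⟩
  · have := RealDivGrading.finite_of_finrank h1
    obtain ⟨β, f, hβ⟩ := RealDivGrading.exists_isCommutationForm hdiv h1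
    -- The two forms are distinguished by whether the grading group has exponent two.
    by_cases h2 : ∀ g : G, 2 • g = 0
    · obtain ⟨k, φ, α, h⟩ := hβ.weaklyIsomorphic_typeOne h1 h2
      obtain ⟨e⟩ := RealDivGrading.nonempty_algOne_algEquiv k
      obtain ⟨γ⟩ := RealDivGrading.nonempty_addEquiv_elementary k
      exact ⟨k, RealDivGrading.eq_of_matrix_algEquiv (φ.trans e),
        Or.inl ⟨⟨φ, α, h⟩, ⟨α.trans γ⟩⟩⟩
    · obtain ⟨m, φ, α, h⟩ := hβ.weaklyIsomorphic_typeTwo h1 (not_forall.1 h2)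
      obtain ⟨e⟩ := RealDivGrading.nonempty_algTwo_algEquiv m
      obtain ⟨γ⟩ := RealDivGrading.nonempty_addEquiv_four m
      exact ⟨m + 1, RealDivGrading.eq_of_matrix_algEquiv (φ.trans e),
        Or.inr ⟨m, rfl, ⟨φ, α, h⟩, ⟨α.trans γ⟩⟩⟩
  · obtain ⟨B, hB⟩ := RealDivGrading.exists_basis_basisOne k
    obtain ⟨e⟩ := RealDivGrading.nonempty_algOne_algEquiv k
    rw [RealDivGrading.typeOne_eq_span]
    exact (RealDivGrading.isTwisted_basisOne k).exists_weaklyIsomorphic (S := RealDivGrading.AlgOne k) B hB e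
  · obtain ⟨B, hB⟩ := RealDivGrading.exists_basis_basisTwo m
    obtain ⟨e⟩ := RealDivGrading.nonempty_algTwo_algEquiv m
    rw [RealDivGrading.typeTwo_eq_span]
    exact (RealDivGrading.isTwisted_basisTwo m).exists_weaklyIsomorphic
      (S := RealDivGrading.AlgTwo m) B hB e
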